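/- Let $\mathfrak{su}(2)$ denote the complex Lie algebra with basis $\mathfrak{s}^1,\mathfrak{s}^2,\mathfrak{s}^3$ and brackets $[\mathfrak{s}^\alpha,\mathfrak{s}^\beta]=i\,\epsilon_{\alpha\beta\gamma}\,\mathfrak{s}^\gamma$ (that is, the complexification of the real Lie algebra of that name). For $j\in\{0,\tfrac12,1,\tfrac32,\dots\}$ let $[2j]$ be its irreducible complex representation of dimension $2j+1$, which is unique up to isomorphism. Let $j_1,j_2,j_3\in\{0,\tfrac12,1,\tfrac32,\dots\}$ and let $V=[2j_1]\otimes[2j_2]\otimes[2j_3]$. Write $s^\alpha_a\in\mathrm{End}(V)$ for the action of $\mathfrak{s}^\alpha$ on the $a$-th tensor factor (the identity on the other two factors), and put $$K_{12}=\sum_{\alpha=1}^3(s_1^\alpha+s_2^\alpha)^2,\qquad K_{23}=\sum_{\alpha=1}^3(s_2^\alpha+s_3^\alpha)^2,\qquad K_{123}=\sum_{\alpha=1}^3(s_1^\alpha+s_2^\alpha+s_3^\alpha)^2 .$$ Let $$\mathcal{C}_{j_1j_2j_3}=\mathrm{End}_{\mathfrak{su}(2)}(V)=\{M\in\mathrm{End}(V)\;:\;[M,s_1^\alpha+s_2^\alpha+s_3^\alpha]=0,\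 \alpha=1,2,3\}$$ be the centralizer of the diagonal action of $\mathfrak{su}(2)$. Let the universal Racah algebra $\mathcal{R}(\alpha_1,\alpha_2,\alpha_3)$ be the unital associative complex algebra generated by $A$, $B$ and central elements $C,\alpha_1,\alpha_2,\alpha_3$ with the relations $$[B,[A,B]]=-2B^2-2\{A,B\}+2(C+\alpha_1+\alpha_2+\alpha_3)B+2(\alpha_1-C)(\alpha_3-\alpha_2),$$ $$[A,[B,A]]=-2A^2-2\{A,B\}+2(C+\alpha_1+\alpha_2+\alpha_3)A+2(\alpha_1-\alpha_2)(\alpha_3-C),$$ where $[x,y]=xy-yx$ and $\{x,y\}=xy+yx$. Then there is a unique homomorphism of unital complex algebras $\phi:\mathcal{R}(\alpha_1,\alpha_2,\alpha_3)\to\mathcal{C}_{j_1j_2j_3}$ with $$\phi(A)=K_{12},\qquad \phi(B)=K_{23},\qquad \phi(C)=K_{123},\qquad \phi(\alpha_i)=j_i(j_i+1)\,\mathrm{Id}\quad(i=1,2,3),$$ and $\phi$ is surjective. Equivalently, $K_{12}$, $K_{23}$ and $K_{123}$ generate $\mathcal{C}_{j_1j_2j_3}$ as a unital complex algebra. -/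

import Mathlib

open scoped TensorProduct

noncomputable section

/-! ### The Lie algebra `su(2)` -/

/-- The Lie algebra `su(2)` in its complex form, that is, the complex Lie algebra of traceless
`2 × 2` matrices.  It has the basis `su2.s 0, su2.s 1, su2.s 2` below, with
`[s^α, s^β] = i ε_{αβγ} s^γ`. -/
abbrev su2 : Type := LieAlgebra.SpecialLinear.sl (Fin 2) ℂ

namespace su2

/-- The generators `s^1, s^2, s^3`, indexed by `0, 1, 2`: one half of the Pauli matrices. -/
def s : Fin 3 → su2 :=
  ![⟨!![0, 1 / 2; 1 / 2, 0], by simp [LieAlgebra.SpecialLinear.sl]⟩,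
    ⟨!![0, -(Complex.I / 2); Complex.I / 2, 0], by simp [LieAlgebra.SpecialLinear.sl]⟩,
    ⟨!![1 / 2, 0; 0, -(1 / 2)], by simp [LieAlgebra.SpecialLinear.sl]⟩]

/-- The defining relations `[s^1, s^2] = i s^3`, `[s^2, s^3] = i s^1`, `[s^3, s^1] = i s^2`
(indices modulo `3`). -/
theorem s_lie_s (a : Fin 3) : ⁅s a, s (a + 1)⁆ = Complex.I • s (a + 2) := by
  apply Subtype.ext
  rw [LieAlgebra.SpecialLinear.sl_bracket]
  fin_cases a <;> ext i j <;> fin_cases i <;> fin_cases j <;>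
    simp [s] <;> ring_nf <;> simp <;> norm_num

/-- The generators span `su(2)`. -/
theorem span_s : Submodule.span ℂ (Set.range s) = ⊤ := by
  rw [eq_top_iff]
  rintro ⟨M, hM⟩ -
  have htr : M 0 0 + M 1 1 = 0 := by
    simpa [LieAlgebra.SpecialLinear.sl, Matrix.trace_fin_two] using hM
  have key : (⟨M, hM⟩ : su2) =
      (M 0 1 + M 1 0) • s 0 + (Complex.I * (M 0 1 - M 1 0)) • s 1 + (2 * M 0 0) • s 2 := by
    apply Subtype.ext
    ext i j
    fin_cases i <;> fin_cases j <;> simp [s]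
    · ring
    · linear_combination (M 0 1 - M 1 0) / 2 * Complex.I_sq
    · linear_combination -(M 0 1 - M 1 0) / 2 * Complex.I_sq
    · linear_combination htr
  rw [key]
  have hs : ∀ a, s a ∈ Submodule.span ℂ (Set.range s) := fun a =>
    Submodule.subset_span ⟨a, rfl⟩
  exact Submodule.add_mem _ (Submodule.add_mem _ (Submodule.smul_mem _ _ (hs 0))
    (Submodule.smul_mem _ _ (hs 1))) (Submodule.smul_mem _ _ (hs 2))

end su2

/-! ### The universal Racah algebra -/

namespace Racah

/-- Symbols for the generators: `A`, `B`, `C` and `α_1, α_2, α_3` (indexed by `0, 1, 2`). -/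
inductive Gen : Type
  | A : Gen
  | B : Gen
  | C : Gen
  | α : Fin 3 → Gen

/-- The generators as elements of the free algebra. -/
abbrev gen (g : Gen) : FreeAlgebra ℂ Gen := FreeAlgebra.ι ℂ g

/-- The commutator `[x, y]`. -/
def comm {R : Type*} [Ring R] (x y : R) : R := x * y - y * x

/-- The anticommutator `{x, y}`. -/
def acomm {R : Type*} [Ring R] (x y : R) : R := x * y + y * x

open Gen in
/-- The defining relations of the universal Racah algebra. -/
inductive Rel : FreeAlgebra ℂ Gen → FreeAlgebra ℂ Gen → Prop
  | central_α (i : Fin 3) (g : Gen) : Rel (gen (α i) * gen g) (gen g * gen (α i))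
  | central_C (g : Gen) : Rel (gen C * gen g) (gen g * gen C)
  | relB : Rel (comm (gen B) (comm (gen A) (gen B)))
      (-2 * gen B ^ 2 - 2 * acomm (gen A) (gen B)
        + 2 * (gen C + gen (α 0) + gen (α 1) + gen (α 2)) * gen B
        + 2 * (gen (α 0) - gen C) * (gen (α 2) - gen (α 1)))
  | relA : Rel (comm (gen A) (comm (gen B) (gen A)))
      (-2 * gen A ^ 2 - 2 * acomm (gen A) (gen B)
        + 2 * (gen C + gen (α 0) + gen (α 1) + gen (α 2)) * gen A
        + 2 * (gen (α 0) - gen (α 1)) * (gen (α 2) - gen C))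

end Racah

/-- The universal Racah algebra: the unital associative complex algebra generated by `A`, `B` and
central elements `C`, `α_1`, `α_2`, `α_3`, subject to the relations `Racah.Rel`. -/
abbrev RacahAlgebra : Type := RingQuot Racah.Rel

namespace RacahAlgebra

/-- The image of a generator in the universal Racah algebra. -/
def of (g : Racah.Gen) : RacahAlgebra := RingQuot.mkAlgHom ℂ Racah.Rel (Racah.gen g)

/-- The generator `A`. -/
def A : RacahAlgebra := of Racah.Gen.A

/-- The generator `B`. -/
def B : RacahAlgebra := of Racah.Gen.B

/-- The central generator `C`. -/
def C : RacahAlgebra := of Racah.Gen.C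

/-- The central generators `α_1, α_2, α_3`, indexed by `0, 1, 2`. -/
def α (i : Fin 3) : RacahAlgebra := of (Racah.Gen.α i)

end RacahAlgebra

/-! ### Spin representations, Casimirs and the centralizer -/

/-- `V` is the spin-`n/2` representation `[n]` of `su(2)`: the irreducible complex representation
of dimension `n + 1`, which is unique up to isomorphism. -/
structure IsSpinRep (n : ℕ) (V : Type*) [AddCommGroup V] [Module ℂ V]
    [LieRingModule su2 V] [LieModule ℂ su2 V] : Prop where
  irreducible : LieModule.IsIrreducible ℂ su2 V
  finrank_eq : Module.finrank ℂ V = n + 1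

/-- The eigenvalue `j (j + 1)` of the Casimir element on the spin-`j` representation, `j = n/2`. -/
def casimirValue (n : ℕ) : ℂ := ((n : ℂ) / 2) * ((n : ℂ) / 2 + 1)

namespace ThreeSpins

variable (V₁ V₂ V₃ : Type*)
  [AddCommGroup V₁] [Module ℂ V₁] [LieRingModule su2 V₁] [LieModule ℂ su2 V₁]
  [AddCommGroup V₂] [Module ℂ V₂] [LieRingModule su2 V₂] [LieModule ℂ su2 V₂]
  [AddCommGroup V₃] [Module ℂ V₃] [LieRingModule su2 V₃] [LieModule ℂ su2 V₃]

/-- `s^a_1`: the generator `s^a` acting on the first tensor factor. -/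
def S₁ (a : Fin 3) : Module.End ℂ (V₁ ⊗[ℂ] V₂ ⊗[ℂ] V₃) :=
  TensorProduct.map (TensorProduct.map (LieModule.toEnd ℂ su2 V₁ (su2.s a)) LinearMap.id)
    LinearMap.id

/-- `s^a_2`: the generator `s^a` acting on the second tensor factor. -/
def S₂ (a : Fin 3) : Module.End ℂ (V₁ ⊗[ℂ] V₂ ⊗[ℂ] V₃) :=
  TensorProduct.map (TensorProduct.map LinearMap.id (LieModule.toEnd ℂ su2 V₂ (su2.s a)))
    LinearMap.id

/-- `s^a_3`: the generator `s^a` acting on the third tensor factor. -/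
def S₃ (a : Fin 3) : Module.End ℂ (V₁ ⊗[ℂ] V₂ ⊗[ℂ] V₃) :=
  TensorProduct.map LinearMap.id (LieModule.toEnd ℂ su2 V₃ (su2.s a))

/-- The total action of `s^a` is the action on the tensor product of Lie modules. -/
theorem S₁_add_S₂_add_S₃ (a : Fin 3) :
    S₁ V₁ V₂ V₃ a + S₂ V₁ V₂ V₃ a + S₃ V₁ V₂ V₃ a =
      LieModule.toEnd ℂ su2 (V₁ ⊗[ℂ] V₂ ⊗[ℂ] V₃) (su2.s a) := by
  ext x y z
  simp [S₁, S₂, S₃, TensorProduct.add_tmul]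

/-- The intermediate Casimir `K_{12}`. -/
def K₁₂ : Module.End ℂ (V₁ ⊗[ℂ] V₂ ⊗[ℂ] V₃) :=
  ∑ a, (S₁ V₁ V₂ V₃ a + S₂ V₁ V₂ V₃ a) ^ 2

/-- The intermediate Casimir `K_{23}`. -/
def K₂₃ : Module.End ℂ (V₁ ⊗[ℂ] V₂ ⊗[ℂ] V₃) :=
  ∑ a, (S₂ V₁ V₂ V₃ a + S₃ V₁ V₂ V₃ a) ^ 2

/-- The total Casimir `K_{123}`. -/
def K₁₂₃ : Module.End ℂ (V₁ ⊗[ℂ] V₂ ⊗[ℂ] V₃) :=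
  ∑ a, (S₁ V₁ V₂ V₃ a + S₂ V₁ V₂ V₃ a + S₃ V₁ V₂ V₃ a) ^ 2

/-- The centralizer of the image of `su(2)` in the endomorphisms of `V₁ ⊗ V₂ ⊗ V₃`: all `M` with
`[M, s^a_1 + s^a_2 + s^a_3] = 0` for every `a`. -/
def centralizer : Subalgebra ℂ (Module.End ℂ (V₁ ⊗[ℂ] V₂ ⊗[ℂ] V₃)) :=
  Subalgebra.centralizer ℂ
    (Set.range fun a : Fin 3 => S₁ V₁ V₂ V₃ a + S₂ V₁ V₂ V₃ a + S₃ V₁ V₂ V₃ a)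

/-- Membership in the centralizer means being an endomorphism of the `su(2)`-module. -/
theorem mem_centralizer_iff (M : Module.End ℂ (V₁ ⊗[ℂ] V₂ ⊗[ℂ] V₃)) :
    M ∈ centralizer V₁ V₂ V₃ ↔ ∀ (x : su2) (v : V₁ ⊗[ℂ] V₂ ⊗[ℂ] V₃), M ⁅x, v⁆ = ⁅x, M v⁆ := by
  simp only [centralizer, S₁_add_S₂_add_S₃, Subalgebra.mem_centralizer_iff, Set.forall_mem_range]
  constructor
  · intro h x v
    have hx : x ∈ Submodule.span ℂ (Set.range su2.s) := su2.span_s ▸ Submodule.mem_top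
    induction hx using Submodule.span_induction with
    | mem x hx =>
      obtain ⟨a, rfl⟩ := hx
      exact (LinearMap.congr_fun (h a) v).symm
    | zero => simp
    | add x y _ _ hx hy => simp [hx, hy]
    | smul c x _ hx => simp [hx]
  · intro h a
    exact LinearMap.ext fun v => (h (su2.s a) v).symm

/-- `φ` is the homomorphism with `A ↦ K_{12}`, `B ↦ K_{23}`, `C ↦ K_{123}` and
`α_i ↦ j_i (j_i + 1)`, where `j_i = n_i / 2`. -/
structure IsRacahMap (n₁ n₂ n₃ : ℕ) (φ : RacahAlgebra →ₐ[ℂ] centralizer V₁ V₂ V₃) : Prop where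
  map_A : (φ RacahAlgebra.A : Module.End ℂ (V₁ ⊗[ℂ] V₂ ⊗[ℂ] V₃)) = K₁₂ V₁ V₂ V₃
  map_B : (φ RacahAlgebra.B : Module.End ℂ (V₁ ⊗[ℂ] V₂ ⊗[ℂ] V₃)) = K₂₃ V₁ V₂ V₃
  map_C : (φ RacahAlgebra.C : Module.End ℂ (V₁ ⊗[ℂ] V₂ ⊗[ℂ] V₃)) = K₁₂₃ V₁ V₂ V₃
  map_α₁ : φ (RacahAlgebra.α 0) = algebraMap ℂ _ (casimirValue n₁)
  map_α₂ : φ (RacahAlgebra.α 1) = algebraMap ℂ _ (casimirValue n₂)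
  map_α₃ : φ (RacahAlgebra.α 2) = algebraMap ℂ _ (casimirValue n₃)

end ThreeSpins

end

/-! The relations come from one identity for vector operators. If v transforms as a vector under the
spin L, then [L²,[L²,v]] = 2{L²,v} - 4(v·L)L. Take L = s₂ + s₃ and v = s₂, and contract with s₁,
which commutes with both. Since K₁₂ is a constant plus 2 s₁·s₂, this gives the double commutator
[K₂₃,[K₁₂,K₂₃]], and the products s₂·L and s₁·L are affine in K₂₃ and K₁₂₃
(`Racah.comm_comm_casimir`). The other relation follows by exchanging spins 1 and 3. Existence and
uniqueness of the homomorphism are then formal.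

For surjectivity, choose an inner product on V for which all spin operators are symmetric. An
operator commuting with the total raising and lowering operators E and F is determined by its
restriction to ker E (`UnitaryTriple.eq_zero_of_forall_ker`). The restricted Casimirs are symmetric,
so by the double commutant theorem (`mem_adjoin_of_forall_commute`) it is enough that every operator
Y on ker E commuting with the three of them commutes with the restriction of the centralizer. That
restriction preserves each space W of highest weight vectors of a fixed weight, so it suffices that
Y is a scalar on each W (`CommutingTriples.exists_scalar`).

K₁₂₃ separates the spaces W, so Y preserves them. A vector w of W is determined by its inner
products with the monomials f₀^a f₁^b f₂^c Ω. Since Ew = 0, these moments satisfy a three-term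
linear relation that removes the middle exponent, leaving only the moments (a,0,c) with a + c = d.
On these, K₁₂ and K₂₃ are bidiagonal in opposite directions. The lowest admissible moment is
therefore an eigenfunctional of K₁₂, and it is represented by a vector p of W. Its eigenvalue is
simple (`CommutingTriples.eq_zero_of_cas₁₂`) and p is cyclic for K₂₃
(`CommutingTriples.eq_zero_of_cas₂₃_pow`). Hence Yp = xp, and commuting with K₂₃ spreads the scalar
x over W. -/

noncomputable section

set_option linter.unnecessarySeqFocus false

/-! ### Vector operators and the Racah relation. -/

namespace Racah

/-- `v` is a vector operator for `L`: `[L^α, v^β] = i ε_{αβγ} v^γ`. -/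
structure IsVectorOperator {R : Type*} [Ring R] [Algebra ℂ R] (L v : Fin 3 → R) : Prop where
  same (a : Fin 3) : L a * v a = v a * L a
  next (a : Fin 3) : L a * v (a + 1) = v (a + 1) * L a + Complex.I • v (a + 2)
  prev (a : Fin 3) : L (a + 1) * v a = v a * L (a + 1) - Complex.I • v (a + 2)

variable {R : Type*} [Ring R] [Algebra ℂ R]

/-- The sum of squares of the three components. -/
def normSq (L : Fin 3 → R) : R := ∑ a, L a ^ 2

theorem IsVectorOperator.add {L M v w : Fin 3 → R} (hL : IsVectorOperator L v)
    (hM : ∀ a b, M a * v b = v b * M a) (hL' : ∀ a b, L a * w b = w b * L a)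
    (hM' : IsVectorOperator M w) : IsVectorOperator (L + M) (v + w) where
  same a := by
    simp only [Pi.add_apply, add_mul, mul_add, hL.same, hM, hL', hM'.same]; abel
  next a := by
    simp only [Pi.add_apply, add_mul, mul_add, hL.next, hM, hL', hM'.next, smul_add]; abel
  prev a := by
    simp only [Pi.add_apply, add_mul, mul_add, hL.prev, hM, hL', hM'.prev, smul_add]; abel

theorem IsVectorOperator.add_left {L M v : Fin 3 → R} (hL : IsVectorOperator L v)
    (hM : ∀ a b, M a * v b = v b * M a) : IsVectorOperator (L + M) v where
  same a := by simp only [Pi.add_apply, add_mul, mul_add, hL.same, hM]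
  next a := by simp only [Pi.add_apply, add_mul, mul_add, hL.next, hM]; abel
  prev a := by simp only [Pi.add_apply, add_mul, mul_add, hL.prev, hM]; abel

/-- Only the two components of L other than L_a fail to commute with v_a; moving their squares past
v_a leaves a cross product v × L and a second-order remainder 2 v_a. -/
theorem IsVectorOperator.normSq_comm {L v : Fin 3 → R} (h : IsVectorOperator L v) (a : Fin 3) :
    normSq L * v a - v a * normSq L =
      (2 : ℂ) • v a + (2 * Complex.I) • (v (a + 1) * L (a + 2) - v (a + 2) * L (a + 1)) := by
  have key : ∀ p q x y z : R, p * x = x * p - Complex.I • z → q * x = x * q + Complex.I • y →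
      p * z = z * p + Complex.I • x → q * y = y * q - Complex.I • x →
      (p ^ 2 + q ^ 2) * x - x * (p ^ 2 + q ^ 2) =
        (2 : ℂ) • x + (2 * Complex.I) • (y * q - z * p) := by
    intro p q x y z h₁ h₂ h₃ h₄
    have e₁ : p ^ 2 * x = x * p ^ 2 - (2 * Complex.I) • (z * p) + x := by
      rw [pow_two, mul_assoc, h₁, mul_sub, ← mul_assoc, h₁, mul_smul_comm, h₃, smul_add,
        smul_smul, Complex.I_mul_I, sub_mul, mul_assoc, smul_mul_assoc, mul_smul]
      module
    have e₂ : q ^ 2 * x = x * q ^ 2 + (2 * Complex.I) • (y * q) + x := by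
      rw [pow_two, mul_assoc, h₂, mul_add, ← mul_assoc, h₂, mul_smul_comm, h₄, smul_sub,
        smul_smul, Complex.I_mul_I, add_mul, mul_assoc, smul_mul_assoc, mul_smul]
      module
    rw [add_mul, e₁, e₂, mul_add]
    module
  have hs : normSq L = L a ^ 2 + (L (a + 1) ^ 2 + L (a + 2) ^ 2) := by
    fin_cases a <;> simp [normSq, Fin.sum_univ_three] <;> abel
  have h0 : L a ^ 2 * v a = v a * L a ^ 2 := by
    rw [pow_two, mul_assoc, h.same, ← mul_assoc, h.same, mul_assoc]
  have a21 : a + 2 + 1 = a := by fin_cases a <;> rfl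
  have a22 : a + 2 + 2 = a + 1 := by fin_cases a <;> rfl
  have a11 : a + 1 + 1 = a + 2 := by fin_cases a <;> rfl
  have a12 : a + 1 + 2 = a := by fin_cases a <;> rfl
  have n1 := h.next (a + 1)
  have n2 := h.next (a + 2)
  have p1 := h.prev (a + 1)
  have p2 := h.prev (a + 2)
  rw [a21, a22] at n2 p2
  rw [a11, a12] at n1 p1
  rw [hs, add_mul, mul_add, h0, add_sub_add_left_eq_sub]
  exact key _ _ _ _ _ (h.prev a) n2 n1 p1

/-- For v = L the cross product is i L_a, so the second term of `normSq_comm` is (2i)(i) L_a = -2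
L_a and cancels the first. -/
theorem IsVectorOperator.normSq_commute {L : Fin 3 → R} (h : IsVectorOperator L L) (a : Fin 3) :
    normSq L * L a = L a * normSq L := by
  have h₁ := h.normSq_comm a
  have h₂ := h.next (a + 1)
  have a11 : a + 1 + 1 = a + 2 := by fin_cases a <;> rfl
  have a12 : a + 1 + 2 = a := by fin_cases a <;> rfl
  rw [a11, a12] at h₂
  rw [h₂, add_sub_cancel_left, smul_smul, mul_assoc, Complex.I_mul_I] at h₁
  rw [← sub_eq_zero, h₁]
  module

/-- The double commutator of a vector operator with the Casimir. -/
theorem IsVectorOperator.double_comm {L v : Fin 3 → R} (hL : IsVectorOperator L L)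
    (h : IsVectorOperator L v) (a : Fin 3) :
    comm (normSq L) (comm (normSq L) (v a)) =
      (2 : ℂ) • (normSq L * v a + v a * normSq L) - (4 : ℂ) • ((∑ b, v b * L b) * L a) := by
  have a21 : a + 2 + 1 = a := by fin_cases a <;> rfl
  have a22 : a + 2 + 2 = a + 1 := by fin_cases a <;> rfl
  have a11 : a + 1 + 1 = a + 2 := by fin_cases a <;> rfl
  have a12 : a + 1 + 2 = a := by fin_cases a <;> rfl
  have d0 := h.normSq_comm a
  have d1 := h.normSq_comm (a + 1)
  have d2 := h.normSq_comm (a + 2)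
  rw [a21, a22] at d2
  rw [a11, a12] at d1
  have hs : normSq L = L a ^ 2 + (L (a + 1) ^ 2 + L (a + 2) ^ 2) := by
    fin_cases a <;> simp [normSq, Fin.sum_univ_three] <;> abel
  have ht : ∑ b, v b * L b = v a * L a + (v (a + 1) * L (a + 1) + v (a + 2) * L (a + 2)) := by
    fin_cases a <;> simp [Fin.sum_univ_three] <;> abel
  have c1 := hL.normSq_commute (a + 1)
  have c2 := hL.normSq_commute (a + 2)
  have n0 := hL.next a
  have n2 := hL.next (a + 2)
  rw [a21, a22] at n2
  simp only [comm]
  -- L² commutes with every component of L, so in a product v_b L_c the outer commutator acts on v_b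
  -- alone and `normSq_comm` applies a second time.
  have e1 : normSq L * (v (a + 1) * L (a + 2)) - v (a + 1) * L (a + 2) * normSq L =
      (normSq L * v (a + 1) - v (a + 1) * normSq L) * L (a + 2) := by
    rw [mul_assoc (v (a + 1)), ← c2]; noncomm_ring
  have e2 : normSq L * (v (a + 2) * L (a + 1)) - v (a + 2) * L (a + 1) * normSq L =
      (normSq L * v (a + 2) - v (a + 2) * normSq L) * L (a + 1) := by
    rw [mul_assoc (v (a + 2)), ← c1]; noncomm_ring
  have e3 : normSq L * (normSq L * v a - v a * normSq L)
        - (normSq L * v a - v a * normSq L) * normSq L =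
      (2 : ℂ) • (normSq L * v a - v a * normSq L) + (2 * Complex.I) •
        ((normSq L * v (a + 1) - v (a + 1) * normSq L) * L (a + 2) -
          (normSq L * v (a + 2) - v (a + 2) * normSq L) * L (a + 1)) := by
    rw [← e1, ← e2]
    conv_lhs => rw [d0]
    simp only [mul_add, add_mul, mul_smul_comm, smul_mul_assoc, mul_sub, sub_mul]
    module
  -- Trading the anticommutator for the commutator makes both sides expressions with every v to the
  -- left of every L, up to reordering two components of L.
  have e4 : normSq L * v a + v a * normSq L =
      (normSq L * v a - v a * normSq L) + (2 : ℂ) • (v a * normSq L) := by module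
  rw [e3, e4, d1, d2, d0, ht, hs]
  have n0' : v (a + 1) * L (a + 1) * L a =
      v (a + 1) * L a * L (a + 1) - Complex.I • (v (a + 1) * L (a + 2)) := by
    rw [mul_assoc, mul_assoc, n0, mul_add, mul_smul_comm]; abel
  have n2' : v (a + 2) * L (a + 2) * L a =
      v (a + 2) * L a * L (a + 2) + Complex.I • (v (a + 2) * L (a + 1)) := by
    rw [mul_assoc, mul_assoc, n2, mul_add, mul_smul_comm]
  simp only [add_mul, sub_mul, mul_add, smul_mul_assoc, n0', n2', smul_add, smul_sub, pow_two,
    ← mul_assoc]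
  match_scalars <;> ring_nf <;> simp only [Complex.I_sq] <;> ring_nf

theorem normSq_add {R : Type*} [Ring R] [Algebra ℂ R] {x y : Fin 3 → R}
    (h : ∀ a b, x a * y b = y b * x a) :
    normSq (x + y) = normSq x + normSq y + (2 : ℂ) • ∑ a, x a * y a := by
  simp only [normSq, Finset.smul_sum, ← Finset.sum_add_distrib, Pi.add_apply]
  refine Finset.sum_congr rfl fun a _ => ?_
  rw [pow_two, pow_two, pow_two, add_mul, mul_add, mul_add, ← h a a, two_smul]
  abel

theorem commute_sum_mul {R : Type*} [Ring R] {u : R} {x y : Fin 3 → R} (hx : ∀ a, u * x a = x a * u)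
    (hy : ∀ a, u * y a = y a * u) : u * ∑ a, x a * y a = (∑ a, x a * y a) * u := by
  rw [Finset.mul_sum, Finset.sum_mul]
  exact Finset.sum_congr rfl fun a _ => by rw [← mul_assoc, hx, mul_assoc, hy, mul_assoc]

theorem normSq_commute_of {R : Type*} [Ring R] {u : R} {x : Fin 3 → R}
    (hx : ∀ a, u * x a = x a * u) :
    normSq x * u = u * normSq x := by
  simp only [normSq, pow_two]
  exact (commute_sum_mul hx hx).symm

/-- The Racah relation for three commuting spins. -/
theorem comm_comm_casimir {R : Type*} [Ring R] [Algebra ℂ R] {x y z : Fin 3 → R}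
    (hy : IsVectorOperator y y)
    (hz : IsVectorOperator z z) (hxy : ∀ a b, x a * y b = y b * x a)
    (hxz : ∀ a b, x a * z b = z b * x a) (hyz : ∀ a b, y a * z b = z b * y a) {a₁ a₂ a₃ : ℂ}
    (h₁ : normSq x = algebraMap ℂ R a₁) (h₂ : normSq y = algebraMap ℂ R a₂)
    (h₃ : normSq z = algebraMap ℂ R a₃) :
    comm (normSq (y + z)) (comm (normSq (x + y)) (normSq (y + z))) =
      -2 * normSq (y + z) ^ 2 - 2 * acomm (normSq (x + y)) (normSq (y + z))
        + 2 * (normSq (x + y + z) + algebraMap ℂ R a₁ + algebraMap ℂ R a₂ + algebraMap ℂ R a₃)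
          * normSq (y + z)
        + 2 * (algebraMap ℂ R a₁ - normSq (x + y + z))
          * (algebraMap ℂ R a₃ - algebraMap ℂ R a₂) := by
  have hL : IsVectorOperator (y + z) (y + z) :=
    hy.add (fun a b => (hyz b a).symm) hyz hz
  have hLy : IsVectorOperator (y + z) y := hy.add_left (fun a b => (hyz b a).symm)
  have hxL : ∀ a b, x a * (y + z) b = (y + z) b * x a := fun a b => by
    simp only [Pi.add_apply, mul_add, add_mul, hxy, hxz]
  have hdc := hL.double_comm hLy
  have hA := normSq_add hxy
  have hB := normSq_add hyz
  have hC := normSq_add hxL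
  have hD : ∑ b, y b * (y + z) b = normSq y + ∑ b, y b * z b := by
    simp only [normSq, ← Finset.sum_add_distrib, Pi.add_apply, mul_add, pow_two]
  rw [← add_assoc] at hC
  have hBx : ∀ a, normSq (y + z) * x a = x a * normSq (y + z) := fun a =>
    normSq_commute_of (hxL a)
  have hBX : normSq (y + z) * ∑ a, x a * (y + z) a = (∑ a, x a * (y + z) a) * normSq (y + z) :=
    commute_sum_mul hBx hL.normSq_commute
  have hxD : ∀ a, (∑ b, y b * (y + z) b) * x a = x a * ∑ b, y b * (y + z) b := fun a =>
    (commute_sum_mul (hxy a) (hxL a)).symm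
  set B := normSq (y + z)
  set D := ∑ b, y b * (y + z) b
  set P := ∑ a, x a * y a
  set X := ∑ a, x a * (y + z) a
  -- D = y² + y·z, while (y + z)² = y² + z² + 2 y·z.
  have hD' : D = (1 / 2 : ℂ) • (B + algebraMap ℂ R a₂ - algebraMap ℂ R a₃) := by
    rw [hD, hB, h₂, h₃]; module
  -- The components of x commute with B and D, so the contraction with x passes through the double
  -- commutator of y.
  have hBP : B * (B * P - P * B) - (B * P - P * B) * B =
      (2 : ℂ) • (B * P + P * B) - (4 : ℂ) • (D * X) := by
    have e₁ : B * P - P * B = ∑ a, x a * comm B (y a) := by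
      simp only [P, comm, Finset.mul_sum, Finset.sum_mul, ← Finset.sum_sub_distrib]
      refine Finset.sum_congr rfl fun a _ => ?_
      rw [← mul_assoc, hBx, mul_sub, mul_assoc, mul_assoc]
    have e₂ : B * (B * P - P * B) - (B * P - P * B) * B = ∑ a, x a * comm B (comm B (y a)) := by
      rw [e₁, Finset.mul_sum, Finset.sum_mul, ← Finset.sum_sub_distrib]
      refine Finset.sum_congr rfl fun a _ => ?_
      rw [← mul_assoc, hBx, comm.eq_1 _ (comm _ _), mul_sub, mul_assoc, mul_assoc]
    rw [e₂]
    simp only [hdc, P, X, Finset.mul_sum, Finset.sum_mul, Finset.smul_sum,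
      ← Finset.sum_sub_distrib, ← Finset.sum_add_distrib]
    refine Finset.sum_congr rfl fun a _ => ?_
    rw [mul_sub, mul_smul_comm, mul_smul_comm, mul_add, ← mul_assoc, ← mul_assoc, ← mul_assoc,
      ← mul_assoc, ← hBx, ← hxD, mul_assoc B, mul_assoc D]
  -- Only the term 2P of (x + y)² fails to be a scalar; the sign comes from reversing the inner
  -- commutator.
  have hco : comm B (comm (normSq (x + y)) B) =
      -((2 : ℂ) • (B * (B * P - P * B) - (B * P - P * B) * B)) := by
    simp only [comm, hA, h₁, h₂, Algebra.algebraMap_eq_smul_one, mul_add, add_mul, mul_sub,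
      sub_mul, mul_smul_comm, smul_mul_assoc, one_mul, mul_one]
    module
  rw [hco, hBP, hD', hC, hA, h₁, h₂]
  simp only [acomm, Algebra.algebraMap_eq_smul_one, mul_add, add_mul, mul_sub, sub_mul, hBX,
    mul_smul_comm, smul_mul_assoc, one_mul, mul_one, two_mul, neg_mul, pow_two]
  module

end Racah

/-! ### Unitary `sl₂`-triples. -/

/-- An `sl₂`-triple acting on an inner product space, with `f` the adjoint of `e`. -/
structure UnitaryTriple {V : Type*} [NormedAddCommGroup V] [InnerProductSpace ℂ V]
    (e f h : Module.End ℂ V) : Prop where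
  e_f (v : V) : e (f v) = f (e v) + h v
  h_e (v : V) : h (e v) = e (h v) + (2 : ℂ) • e v
  h_f (v : V) : h (f v) = f (h v) - (2 : ℂ) • f v
  inner_e (v w : V) : inner ℂ (e v) w = inner ℂ v (f w)

/-- The Casimir operator of a triple. -/
def triCasimir {V : Type*} [AddCommGroup V] [Module ℂ V] (e f h : Module.End ℂ V) :
    Module.End ℂ V :=
  f * e + (1 / 2 : ℂ) • h + (1 / 4 : ℂ) • h ^ 2

theorem triCasimir_apply {V : Type*} [AddCommGroup V] [Module ℂ V] (e f h : Module.End ℂ V)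
    (v : V) : triCasimir e f h v = f (e v) + (1 / 2 : ℂ) • h v + (1 / 4 : ℂ) • h (h v) := by
  simp [triCasimir, pow_two]

namespace UnitaryTriple

variable {V : Type*} [NormedAddCommGroup V] [InnerProductSpace ℂ V] {e f h : Module.End ℂ V}

theorem inner_f (t : UnitaryTriple e f h) (v w : V) : inner ℂ (f v) w = inner ℂ v (e w) := by
  rw [← inner_conj_symm, ← t.inner_e, inner_conj_symm]

/-- h = [e, f] with e and f adjoint to each other, so symmetry of h need not be assumed. -/
theorem inner_h (t : UnitaryTriple e f h) (v w : V) : inner ℂ (h v) w = inner ℂ v (h w) := by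
  have h₁ := t.e_f v
  have h₂ := t.e_f w
  rw [← sub_eq_iff_eq_add'] at h₁ h₂
  rw [← h₁, ← h₂, inner_sub_left, inner_sub_right, t.inner_e, t.inner_f, t.inner_f, t.inner_e]

theorem inner_triCasimir (t : UnitaryTriple e f h) (v w : V) :
    inner ℂ (triCasimir e f h v) w = inner ℂ v (triCasimir e f h w) := by
  simp only [triCasimir_apply, inner_add_left, inner_add_right, inner_smul_left, inner_smul_right,
    t.inner_h, t.inner_f, t.inner_e]
  simp [Complex.conj_ofNat]

theorem e_triCasimir (t : UnitaryTriple e f h) (v : V) :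
    e (triCasimir e f h v) = triCasimir e f h (e v) := by
  simp only [triCasimir_apply, map_add, map_smul, t.e_f, t.h_e, smul_add]
  module

theorem f_triCasimir (t : UnitaryTriple e f h) (v : V) :
    f (triCasimir e f h v) = triCasimir e f h (f v) := by
  simp only [triCasimir_apply, map_add, map_sub, map_smul, t.e_f, t.h_f, smul_sub]
  module

theorem h_triCasimir (t : UnitaryTriple e f h) (v : V) :
    h (triCasimir e f h v) = triCasimir e f h (h v) := by
  simp only [triCasimir_apply, map_add, map_smul, t.h_e, t.h_f]
  module

theorem add {e' f' h' : Module.End ℂ V} (t : UnitaryTriple e f h) (t' : UnitaryTriple e' f' h')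
    (ef : Commute e f') (fe : Commute f e') (he : Commute h e') (eh : Commute e h')
    (hf : Commute h f') (fh : Commute f h') :
    UnitaryTriple (e + e') (f + f') (h + h') := by
  have ef := fun v => LinearMap.congr_fun ef.eq v
  have fe := fun v => LinearMap.congr_fun fe.eq v
  have eh := fun v => LinearMap.congr_fun eh.eq v
  have he := fun v => LinearMap.congr_fun he.eq v
  have hf := fun v => LinearMap.congr_fun hf.eq v
  have fh := fun v => LinearMap.congr_fun fh.eq v
  simp only [Module.End.mul_apply] at ef fe eh he hf fh
  constructor
  · intro v
    simp only [LinearMap.add_apply, map_add, t.e_f, t'.e_f, ef, fe]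
    abel
  · intro v
    simp only [LinearMap.add_apply, map_add, t.h_e, t'.h_e, eh, he, smul_add]
    abel
  · intro v
    simp only [LinearMap.add_apply, map_add, t.h_f, t'.h_f, hf, fh, smul_add]
    abel
  · intro v w
    simp only [LinearMap.add_apply, inner_add_left, inner_add_right, t.inner_e, t'.inner_e]

/-- A highest weight vector has nonnegative weight. -/
theorem weight_nonneg (t : UnitaryTriple e f h) {v : V} {m : ℤ} (he : e v = 0)
    (hh : h v = (m : ℂ) • v) (hv : v ≠ 0) : 0 ≤ m := by
  -- Unitarity turns the weight into a ratio of squared norms: ‖f v‖² = m ‖v‖².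
  have h₁ : inner ℂ (f v) (f v) = (m : ℂ) * inner ℂ v v := by
    rw [t.inner_f, t.e_f, he, map_zero, zero_add, hh, inner_smul_right]
  rw [inner_self_eq_norm_sq_to_K, inner_self_eq_norm_sq_to_K] at h₁
  simp only [Complex.coe_algebraMap] at h₁
  have h₂ : ‖f v‖ ^ 2 = (m : ℝ) * ‖v‖ ^ 2 := by exact_mod_cast h₁
  have h₃ : 0 < ‖v‖ ^ 2 := by positivity
  have h₄ : (0 : ℝ) ≤ m := by
    by_contra hm
    nlinarith [sq_nonneg ‖f v‖, mul_pos_of_neg_of_neg (not_le.mp hm) (neg_lt_zero.mpr h₃)]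
  exact_mod_cast h₄

theorem triCasimir_of_primitive (_t : UnitaryTriple e f h) {v : V} (he : e v = 0) :
    triCasimir e f h v = (1 / 2 : ℂ) • h v + (1 / 4 : ℂ) • h (h v) := by
  rw [triCasimir_apply, he, map_zero, zero_add]

theorem h_primitive (t : UnitaryTriple e f h) {v : V} (he : e v = 0) : e (h v) = 0 := by
  have := t.h_e v
  simpa [he] using this.symm

/-- Among highest weight vectors the Casimir value determines the weight. -/
theorem weight_of_triCasimir (t : UnitaryTriple e f h) {v : V} {m : ℤ} (hm : 0 ≤ m) (he : e v = 0)
    (hv : triCasimir e f h v = ((m : ℂ) / 2 * (m / 2 + 1)) • v) : h v = (m : ℂ) • v := by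
  rw [t.triCasimir_of_primitive he] at hv
  by_contra hne
  -- On ker e the Casimir is a quadratic polynomial in h with roots m and -(m + 2). So (h - m)v, if
  -- nonzero, is a highest weight vector of the negative weight -(m + 2), which unitarity forbids.
  have h₀ : h v - (m : ℂ) • v ≠ 0 := sub_ne_zero.mpr hne
  have h₁ : e (h v - (m : ℂ) • v) = 0 := by rw [map_sub, map_smul, t.h_primitive he, he]; simp
  have h₂ : h (h v - (m : ℂ) • v) = ((-(m + 2) : ℤ) : ℂ) • (h v - (m : ℂ) • v) := by
    have h₃ : h (h v) = (4 : ℂ) • (((m : ℂ) / 2 * (m / 2 + 1)) • v - (1 / 2 : ℂ) • h v) := by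
      rw [← hv]; module
    rw [map_sub, map_smul, h₃]
    push_cast
    module
  have := t.weight_nonneg h₁ h₂ h₀
  omega

theorem e_f_pow (t : UnitaryTriple e f h) {v : V} {n : ℂ} (he : e v = 0) (hh : h v = n • v)
    (k : ℕ) : h ((f ^ k) v) = (n - 2 * k) • (f ^ k) v ∧
      e ((f ^ (k + 1)) v) = ((k + 1) * (n - k)) • (f ^ k) v := by
  induction k with
  | zero => simp [t.e_f, he, hh]
  | succ k ih =>
    have h₁ : h ((f ^ (k + 1)) v) = (n - 2 * (k + 1 : ℕ)) • (f ^ (k + 1)) v := by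
      rw [pow_succ', Module.End.mul_apply, t.h_f, ih.1, map_smul]
      push_cast
      module
    refine ⟨h₁, ?_⟩
    rw [pow_succ', Module.End.mul_apply, t.e_f, ih.2, h₁, map_smul, ← Module.End.mul_apply,
      ← pow_succ']
    push_cast
    module

end UnitaryTriple

/-! ### Double commutant theorem for symmetric operators. -/

/-- The double commutant theorem for a set of symmetric operators in finite dimension. -/
theorem mem_adjoin_of_forall_commute {K : Type*} [NormedAddCommGroup K] [InnerProductSpace ℂ K]
    [FiniteDimensional ℂ K] {S : Set (Module.End ℂ K)} (hS : ∀ T ∈ S, T.IsSymmetric)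
    {M : Module.End ℂ K}
    (hM : ∀ Y : Module.End ℂ K, (∀ T ∈ S, Commute Y T) → Commute Y M) :
    M ∈ Algebra.adjoin ℂ S := by
  set A := Algebra.adjoin ℂ S
  have hadj : ∀ a ∈ A, ∃ a' ∈ A, ∀ x y, inner ℂ (a x) y = inner ℂ x (a' y) := by
    intro a ha
    induction ha using Algebra.adjoin_induction with
    | mem T hT => exact ⟨T, Algebra.subset_adjoin hT, hS T hT⟩
    | algebraMap r =>
      refine ⟨algebraMap ℂ _ (starRingEnd ℂ r), A.algebraMap_mem _, fun x y => ?_⟩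
      rw [Module.algebraMap_end_apply, Module.algebraMap_end_apply, inner_smul_left,
        inner_smul_right]
    | add a b _ _ ha hb =>
      obtain ⟨a', ha', ha⟩ := ha
      obtain ⟨b', hb', hb⟩ := hb
      exact ⟨a' + b', A.add_mem ha' hb', fun x y => by
        rw [LinearMap.add_apply, inner_add_left, ha, hb, LinearMap.add_apply, inner_add_right]⟩
    | mul a b _ _ ha hb =>
      obtain ⟨a', ha', ha⟩ := ha
      obtain ⟨b', hb', hb⟩ := hb
      exact ⟨b' * a', A.mul_mem hb' ha', fun x y => by simp [ha, hb]⟩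
  -- A is closed under adjoints, so the orthogonal complement of an A-submodule is again an
  -- A-submodule.
  have hss : IsSemisimpleModule A K := by
    refine (isSemisimpleModule_iff A K).mpr ⟨fun U => ?_⟩
    let U₀ : Submodule ℂ K := U.restrictScalars ℂ
    have hmem : ∀ {x}, x ∈ U₀ ↔ x ∈ U := Iff.rfl
    refine ⟨{ U₀ᗮ with smul_mem' := fun a x hx => ?_ }, ?_⟩
    · obtain ⟨a', ha', h⟩ := hadj a a.2
      change a.1 x ∈ U₀ᗮ
      have hx : x ∈ U₀ᗮ := hx
      rw [Submodule.mem_orthogonal'] at hx ⊢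
      intro u hu
      rw [h]
      exact hx _ (U.smul_mem ⟨a', ha'⟩ hu)
    · have hc := U₀.isCompl_orthogonal
      constructor
      · rw [Submodule.disjoint_def]
        exact fun x hx hx' => (Submodule.disjoint_def.mp hc.disjoint) x hx hx'
      · rw [codisjoint_iff, Submodule.eq_top_iff']
        intro x
        have := codisjoint_iff.mp hc.codisjoint ▸ Submodule.mem_top (x := x)
        obtain ⟨y, hy, z, hz, rfl⟩ := Submodule.mem_sup.mp this
        exact Submodule.add_mem_sup hy hz
  let f : Module.End (Module.End A K) K :=
    { toFun := M
      map_add' := M.map_add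
      map_smul' := fun Y x => by
        have := hM (Y.restrictScalars ℂ) fun T hT => LinearMap.ext fun x =>
          Y.map_smul ⟨T, Algebra.subset_adjoin hT⟩ x
        exact (LinearMap.congr_fun this.eq x).symm }
  obtain ⟨s, hs⟩ := Module.Finite.fg_top (R := ℂ) (M := K)
  -- Density gives agreement with an element of A only on a finite set; taking that set to span K
  -- makes the two operators equal.
  obtain ⟨r, hr⟩ := jacobson_density (R := A) f s
  have : M = r.1 := by
    refine LinearMap.ext_on (s := (s : Set K)) hs fun m hm => hr m hm
  exact this ▸ r.2

/-! ### Three commuting triples and their monomial vectors. -/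

/-- Three commuting `sl₂`-triples on an inner product space, together with a joint highest weight
vector `Ω` of weights `n 0, n 1, n 2` that generates the space. -/
structure CommutingTriples {V : Type*} [NormedAddCommGroup V] [InnerProductSpace ℂ V]
    (n : Fin 3 → ℕ) (e f h : Fin 3 → Module.End ℂ V) (Ω : V) : Prop where
  triple (i : Fin 3) : UnitaryTriple (e i) (f i) (h i)
  ee {i j : Fin 3} (hij : i ≠ j) : Commute (e i) (e j)
  ef {i j : Fin 3} (hij : i ≠ j) : Commute (e i) (f j)
  ff {i j : Fin 3} (hij : i ≠ j) : Commute (f i) (f j)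
  he {i j : Fin 3} (hij : i ≠ j) : Commute (h i) (e j)
  hf {i j : Fin 3} (hij : i ≠ j) : Commute (h i) (f j)
  hh {i j : Fin 3} (hij : i ≠ j) : Commute (h i) (h j)
  e_Ω (i : Fin 3) : e i Ω = 0
  h_Ω (i : Fin 3) : h i Ω = (n i : ℂ) • Ω
  f_Ω (i : Fin 3) : (f i ^ (n i + 1)) Ω = 0
  total (w : V) (hw : ∀ a b c, inner ℂ ((f 0 ^ a * f 1 ^ b * f 2 ^ c) Ω) w = 0) : w = 0

/-- The relation writes a value with middle exponent b + 1 through values with middle exponent b and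
the same total degree, so everything reduces to middle exponent 0. -/
theorem eq_zero_of_middle_eq_zero {R : Type*} [Ring R] {m : ℕ → ℕ → ℕ → R}
    (hm : ∀ a b c, m (a + 1) b c + m a (b + 1) c + m a b (c + 1) = 0) {d : ℕ}
    (h₀ : ∀ a c, a + c = d → m a 0 c = 0) (b : ℕ) :
    ∀ a c, a + b + c = d → m a b c = 0 := by
  induction b with
  | zero => exact fun a c h => h₀ a c h
  | succ b ih =>
    intro a c h
    have := hm a b c
    rwa [ih (a + 1) c (by omega), ih a (c + 1) (by omega), zero_add, add_zero] at this

namespace CommutingTriples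

variable {V : Type*} [NormedAddCommGroup V] [InnerProductSpace ℂ V]
  {n : Fin 3 → ℕ} {e f h : Fin 3 → Module.End ℂ V} {Ω : V}

/-- The operator `e` of the diagonal action. -/
def diag (e : Fin 3 → Module.End ℂ V) : Module.End ℂ V := e 0 + e 1 + e 2

/-- The monomial vector `f₀^a f₁^b f₂^c Ω`. -/
def mono (f : Fin 3 → Module.End ℂ V) (Ω : V) (a b c : ℕ) : V := (f 0 ^ a * f 1 ^ b * f 2 ^ c) Ω

/-- The Casimir operator of the first two triples. -/
def cas₁₂ (e f h : Fin 3 → Module.End ℂ V) : Module.End ℂ V :=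
  triCasimir (e 0 + e 1) (f 0 + f 1) (h 0 + h 1)

/-- The Casimir operator of the last two triples. -/
def cas₂₃ (e f h : Fin 3 → Module.End ℂ V) : Module.End ℂ V :=
  triCasimir (e 1 + e 2) (f 1 + f 2) (h 1 + h 2)

/-- The Casimir operator of the diagonal action. -/
def cas₁₂₃ (e f h : Fin 3 → Module.End ℂ V) : Module.End ℂ V :=
  triCasimir (diag e) (diag f) (diag h)

theorem triple₁₂ (t : CommutingTriples n e f h Ω) :
    UnitaryTriple (e 0 + e 1) (f 0 + f 1) (h 0 + h 1) :=
  (t.triple 0).add (t.triple 1) (t.ef (by decide)) (t.ef (by decide)).symm (t.he (by decide))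
    (t.he (by decide)).symm (t.hf (by decide)) (t.hf (by decide)).symm

theorem triple₂₃ (t : CommutingTriples n e f h Ω) :
    UnitaryTriple (e 1 + e 2) (f 1 + f 2) (h 1 + h 2) :=
  (t.triple 1).add (t.triple 2) (t.ef (by decide)) (t.ef (by decide)).symm (t.he (by decide))
    (t.he (by decide)).symm (t.hf (by decide)) (t.hf (by decide)).symm

theorem triple₁₂₃ (t : CommutingTriples n e f h Ω) : UnitaryTriple (diag e) (diag f) (diag h) :=
  t.triple₁₂.add (t.triple 2)
    ((t.ef (by decide)).add_left (t.ef (by decide)))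
    ((t.ef (by decide)).symm.add_left (t.ef (by decide)).symm)
    ((t.he (by decide)).add_left (t.he (by decide)))
    ((t.he (by decide)).symm.add_left (t.he (by decide)).symm)
    ((t.hf (by decide)).add_left (t.hf (by decide)))
    ((t.hf (by decide)).symm.add_left (t.hf (by decide)).symm)

theorem f_mono (t : CommutingTriples n e f h Ω) (a b c : ℕ) :
    f 0 (mono f Ω a b c) = mono f Ω (a + 1) b c ∧
    f 1 (mono f Ω a b c) = mono f Ω a (b + 1) c ∧
    f 2 (mono f Ω a b c) = mono f Ω a b (c + 1) := by
  simp only [mono, ← Module.End.mul_apply]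
  refine ⟨?_, ?_, ?_⟩
  · rw [pow_succ', mul_assoc, mul_assoc, mul_assoc]
  · rw [pow_succ' (f 1), ← mul_assoc, ← mul_assoc, ← mul_assoc,
      ((t.ff (show (1 : Fin 3) ≠ 0 by decide)).pow_right a).eq]
  · rw [pow_succ' (f 2), ← mul_assoc, ← mul_assoc (f 0 ^ a * f 1 ^ b),
      (((t.ff (show (2 : Fin 3) ≠ 0 by decide)).pow_right a).mul_right
        ((t.ff (show (2 : Fin 3) ≠ 1 by decide)).pow_right b)).eq]

theorem apply_apply_comm {x y : Module.End ℂ V} (hxy : Commute x y) (v : V) :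
    x (y v) = y (x v) := LinearMap.congr_fun hxy.eq v

/-- Lowering with the other two triples keeps a highest weight vector for triple i of unchanged
weight, so the formulas of `UnitaryTriple.e_f_pow` apply to each factor of a monomial. -/
theorem primitive_pow (t : CommutingTriples n e f h Ω) {i j k : Fin 3} (hij : i ≠ j) (hik : i ≠ k)
    (b c : ℕ) :
    e i ((f j ^ b * f k ^ c) Ω) = 0 ∧
      h i ((f j ^ b * f k ^ c) Ω) = (n i : ℂ) • (f j ^ b * f k ^ c) Ω := by
  have h₁ : Commute (e i) (f j ^ b * f k ^ c) :=
    ((t.ef hij).pow_right b).mul_right ((t.ef hik).pow_right c)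
  have h₂ : Commute (h i) (f j ^ b * f k ^ c) :=
    ((t.hf hij).pow_right b).mul_right ((t.hf hik).pow_right c)
  rw [apply_apply_comm h₁, apply_apply_comm h₂, t.e_Ω, t.h_Ω, map_zero, map_smul]
  exact ⟨rfl, rfl⟩

theorem mono_eq₁ (t : CommutingTriples n e f h Ω) (a b c : ℕ) :
    mono f Ω a b c = (f 1 ^ b) ((f 0 ^ a * f 2 ^ c) Ω) := by
  rw [← Module.End.mul_apply, ← mul_assoc, mono,
    (((t.ff (show (0 : Fin 3) ≠ 1 by decide)).pow_left a).pow_right b).eq]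

theorem mono_eq₂ (t : CommutingTriples n e f h Ω) (a b c : ℕ) :
    mono f Ω a b c = (f 2 ^ c) ((f 0 ^ a * f 1 ^ b) Ω) := by
  rw [← Module.End.mul_apply, mono,
    ((((t.ff (show (0 : Fin 3) ≠ 2 by decide)).pow_left a).mul_left
      ((t.ff (show (1 : Fin 3) ≠ 2 by decide)).pow_left b)).pow_right c).eq]

theorem mono_eq₀ (a b c : ℕ) : mono f Ω a b c = (f 0 ^ a) ((f 1 ^ b * f 2 ^ c) Ω) := by
  rw [← Module.End.mul_apply, mono, mul_assoc]

theorem h_mono (t : CommutingTriples n e f h Ω) (a b c : ℕ) :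
    h 0 (mono f Ω a b c) = ((n 0 : ℂ) - 2 * a) • mono f Ω a b c ∧
    h 1 (mono f Ω a b c) = ((n 1 : ℂ) - 2 * b) • mono f Ω a b c ∧
    h 2 (mono f Ω a b c) = ((n 2 : ℂ) - 2 * c) • mono f Ω a b c := by
  refine ⟨?_, ?_, ?_⟩
  · have := t.primitive_pow (i := 0) (j := 1) (k := 2) (by decide) (by decide) b c
    rw [mono_eq₀]
    exact ((t.triple 0).e_f_pow this.1 this.2 a).1
  · have := t.primitive_pow (i := 1) (j := 0) (k := 2) (by decide) (by decide) a c
    rw [t.mono_eq₁]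
    exact ((t.triple 1).e_f_pow this.1 this.2 b).1
  · have := t.primitive_pow (i := 2) (j := 0) (k := 1) (by decide) (by decide) a b
    rw [t.mono_eq₂]
    exact ((t.triple 2).e_f_pow this.1 this.2 c).1

theorem e₀_mono (t : CommutingTriples n e f h Ω) (a b c : ℕ) :
    e 0 (mono f Ω (a + 1) b c) = (((a : ℂ) + 1) * (n 0 - a)) • mono f Ω a b c := by
  have := t.primitive_pow (i := 0) (j := 1) (k := 2) (by decide) (by decide) b c
  rw [mono_eq₀, mono_eq₀]
  exact ((t.triple 0).e_f_pow this.1 this.2 a).2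

theorem e₂_mono (t : CommutingTriples n e f h Ω) (a b c : ℕ) :
    e 2 (mono f Ω a b (c + 1)) = (((c : ℂ) + 1) * (n 2 - c)) • mono f Ω a b c := by
  have := t.primitive_pow (i := 2) (j := 0) (k := 1) (by decide) (by decide) a b
  rw [t.mono_eq₂, t.mono_eq₂]
  exact ((t.triple 2).e_f_pow this.1 this.2 c).2

theorem e_mono_zero (t : CommutingTriples n e f h Ω) (a b c : ℕ) :
    e 0 (mono f Ω 0 b c) = 0 ∧ e 1 (mono f Ω a 0 c) = 0 ∧
    e 2 (mono f Ω a b 0) = 0 := by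
  rw [mono_eq₀, t.mono_eq₁, t.mono_eq₂]
  simp only [pow_zero (f 0), pow_zero (f 1), pow_zero (f 2), Module.End.one_apply]
  refine ⟨?_, ?_, ?_⟩
  · exact (t.primitive_pow (by decide) (by decide) b c).1
  · exact (t.primitive_pow (by decide) (by decide) a c).1
  · exact (t.primitive_pow (by decide) (by decide) a b).1

theorem f_pow_Ω (t : CommutingTriples n e f h Ω) {i : Fin 3} {a : ℕ} (ha : n i < a) :
    (f i ^ a) Ω = 0 := by
  obtain ⟨k, rfl⟩ := Nat.exists_eq_add_of_lt ha
  rw [show n i + k + 1 = k + (n i + 1) by omega, pow_add, Module.End.mul_apply, t.f_Ω, map_zero]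

theorem mono_eq_zero (t : CommutingTriples n e f h Ω) {a b c : ℕ}
    (habc : n 0 < a ∨ n 1 < b ∨ n 2 < c) : mono f Ω a b c = 0 := by
  rcases habc with h | h | h
  · have : Commute (f 0 ^ a) (f 1 ^ b * f 2 ^ c) :=
      ((t.ff (show (0 : Fin 3) ≠ 1 by decide)).pow_pow a b).mul_right
        ((t.ff (show (0 : Fin 3) ≠ 2 by decide)).pow_pow a c)
    rw [mono_eq₀, apply_apply_comm this, t.f_pow_Ω h, map_zero]
  · have : Commute (f 1 ^ b) (f 0 ^ a * f 2 ^ c) :=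
      ((t.ff (show (1 : Fin 3) ≠ 0 by decide)).pow_pow b a).mul_right
        ((t.ff (show (1 : Fin 3) ≠ 2 by decide)).pow_pow b c)
    rw [t.mono_eq₁, apply_apply_comm this, t.f_pow_Ω h, map_zero]
  · rw [mono, Module.End.mul_apply, t.f_pow_Ω h, map_zero]

end CommutingTriples

/-! ### Moments of highest weight vectors and the bidiagonal action of the Casimirs. -/

namespace CommutingTriples

variable {V : Type*} [NormedAddCommGroup V] [InnerProductSpace ℂ V]
  {n : Fin 3 → ℕ} {e f h : Fin 3 → Module.End ℂ V} {Ω : V}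

/-- The inner product of `w` with the monomial vector of exponents `a, b, c`. -/
def moment (f : Fin 3 → Module.End ℂ V) (Ω w : V) (a b c : ℕ) : ℂ := inner ℂ (mono f Ω a b c) w

/-- The highest weight vectors of weight `∑ n i - 2 d` for the diagonal action. -/
def hwSpace (n : Fin 3 → ℕ) (e h : Fin 3 → Module.End ℂ V) (d : ℕ) : Submodule ℂ V :=
  LinearMap.ker (diag e) ⊓ (diag h).eigenspace ((n 0 + n 1 + n 2 - 2 * d : ℤ) : ℂ)

theorem mem_hwSpace {d : ℕ} {w : V} : w ∈ hwSpace n e h d ↔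
    diag e w = 0 ∧ diag h w = ((n 0 + n 1 + n 2 - 2 * d : ℤ) : ℂ) • w := by
  rw [hwSpace, Submodule.mem_inf, LinearMap.mem_ker, Module.End.mem_eigenspace_iff]

/-- The value of the Casimir operator on spin `s / 2`. -/
def casVal (s : ℤ) : ℂ := (s : ℂ) / 2 * (s / 2 + 1)

/-- The difference of the two values is (s - s')(s + s' + 2)/4. The spurious second root has to be
excluded by size bounds wherever eigenvalues are compared. -/
theorem casVal_eq_iff {s s' : ℤ} : casVal s = casVal s' ↔ s = s' ∨ s + s' + 2 = 0 := by
  have : casVal s - casVal s' = (((s - s') * (s + s' + 2) : ℤ) : ℂ) / 4 := by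
    simp only [casVal]; push_cast; ring
  rw [← sub_eq_zero, this, div_eq_zero_iff, or_iff_left (by norm_num), Int.cast_eq_zero,
    mul_eq_zero, sub_eq_zero]

theorem conj_casVal (s : ℤ) : starRingEnd ℂ (casVal s) = casVal s := by
  simp [casVal, Complex.conj_ofNat]

/-- The sum is the inner product of F·mono with w, that is, of mono with Ew = 0. -/
theorem moment_sum (t : CommutingTriples n e f h Ω) {w : V} (hw : diag e w = 0) (a b c : ℕ) :
    moment f Ω w (a + 1) b c + moment f Ω w a (b + 1) c + moment f Ω w a b (c + 1) = 0 := by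
  obtain ⟨h₀, h₁, h₂⟩ := t.f_mono a b c
  simp only [moment]
  rw [← h₀, ← h₁, ← h₂, ← inner_add_left, ← inner_add_left, ← LinearMap.add_apply,
    ← LinearMap.add_apply]
  exact (t.triple₁₂₃.inner_f _ _).trans (by rw [hw, inner_zero_right])

theorem diag_h_mono (t : CommutingTriples n e f h Ω) (a b c : ℕ) : diag h (mono f Ω a b c) =
    ((n 0 + n 1 + n 2 - 2 * (a + b + c : ℕ) : ℤ) : ℂ) • mono f Ω a b c := by
  obtain ⟨h₀, h₁, h₂⟩ := t.h_mono a b c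
  simp only [diag, LinearMap.add_apply, h₀, h₁, h₂]
  push_cast
  module

theorem moment_weight (t : CommutingTriples n e f h Ω) {w : V} {μ : ℂ} (hw : diag h w = μ • w)
    (a b c : ℕ) :
    ((n 0 + n 1 + n 2 - 2 * (a + b + c : ℕ) : ℤ) : ℂ) * moment f Ω w a b c =
      μ * moment f Ω w a b c := by
  have := t.triple₁₂₃.inner_h (mono f Ω a b c) w
  rwa [hw, t.diag_h_mono, inner_smul_left, inner_smul_right, map_intCast] at this

theorem moment_eq_zero_of_ne (t : CommutingTriples n e f h Ω) {w : V} {d : ℕ}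
    (hw : w ∈ hwSpace n e h d) {a b c : ℕ}
    (habc : a + b + c ≠ d) : moment f Ω w a b c = 0 := by
  have := t.moment_weight (mem_hwSpace.mp hw).2 a b c
  by_contra hne
  have := mul_right_cancel₀ hne this
  rw [Int.cast_inj] at this
  omega

theorem eq_zero_of_moment₁ (t : CommutingTriples n e f h Ω) {w : V} {d : ℕ}
    (hw : w ∈ hwSpace n e h d)
    (hm : ∀ a c, a + c = d → moment f Ω w a 0 c = 0) : w = 0 := by
  refine t.total w fun a b c => ?_
  by_cases habc : a + b + c = d
  · exact eq_zero_of_middle_eq_zero (t.moment_sum (mem_hwSpace.mp hw).1) hm b a c habc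
  · exact t.moment_eq_zero_of_ne hw habc

/-- The relation `moment_sum` is symmetric in the three exponents, so the first can be eliminated as
well as the middle one. This version bounds d by n₁ + n₂. -/
theorem eq_zero_of_moment₀ (t : CommutingTriples n e f h Ω) {w : V} {d : ℕ}
    (hw : w ∈ hwSpace n e h d)
    (hm : ∀ b c, b + c = d → moment f Ω w 0 b c = 0) : w = 0 := by
  refine t.total w fun a b c => ?_
  by_cases habc : a + b + c = d
  · refine eq_zero_of_middle_eq_zero (m := fun b a c => moment f Ω w a b c) (fun b a c => ?_) hm
      a b c (by omega)
    have := t.moment_sum (mem_hwSpace.mp hw).1 a b c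
    rwa [add_comm (moment f Ω w (a + 1) b c)] at this
  · exact t.moment_eq_zero_of_ne hw habc

theorem moment_eq_zero (t : CommutingTriples n e f h Ω) {w : V} {a b c : ℕ}
    (habc : n 0 < a ∨ n 1 < b ∨ n 2 < c) :
    moment f Ω w a b c = 0 := by
  rw [moment, t.mono_eq_zero habc, inner_zero_left]

theorem le_of_ne_zero (t : CommutingTriples n e f h Ω) {w : V} {d : ℕ} (hw : w ∈ hwSpace n e h d)
    (h₀ : w ≠ 0) :
    d ≤ n 1 + n 2 := by
  by_contra hd
  exact h₀ (t.eq_zero_of_moment₀ hw fun b c hbc => t.moment_eq_zero (by omega))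

theorem weight_nonneg_of_ne_zero (t : CommutingTriples n e f h Ω) {w : V} {d : ℕ}
    (hw : w ∈ hwSpace n e h d) (h₀ : w ≠ 0) :
    0 ≤ (n 0 + n 1 + n 2 - 2 * d : ℤ) :=
  t.triple₁₂₃.weight_nonneg (mem_hwSpace.mp hw).1 (mem_hwSpace.mp hw).2 h₀

/-- The Casimir of the combined triple commutes with that triple, and with the third triple because
all of its constituents do. -/
theorem commute_cas₁₂ (t : CommutingTriples n e f h Ω) :
    Commute (cas₁₂ e f h) (diag e) ∧ Commute (cas₁₂ e f h) (diag f) ∧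
    Commute (cas₁₂ e f h) (diag h) := by
  refine ⟨Commute.add_right ?_ ?_, Commute.add_right ?_ ?_, Commute.add_right ?_ ?_⟩
  · exact (LinearMap.ext t.triple₁₂.e_triCasimir).symm
  · have h₁ := (t.ee (show (0 : Fin 3) ≠ 2 by decide)).add_left
      (t.ee (show (1 : Fin 3) ≠ 2 by decide))
    have h₂ := (t.ef (show (2 : Fin 3) ≠ 0 by decide)).symm.add_left
      (t.ef (show (2 : Fin 3) ≠ 1 by decide)).symm
    have h₃ := (t.he (show (0 : Fin 3) ≠ 2 by decide)).add_left
      (t.he (show (1 : Fin 3) ≠ 2 by decide))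
    exact ((h₂.mul_left h₁).add_left (h₃.smul_left _)).add_left ((h₃.pow_left 2).smul_left _)
  · exact (LinearMap.ext t.triple₁₂.f_triCasimir).symm
  · have h₁ := (t.ef (show (0 : Fin 3) ≠ 2 by decide)).add_left
      (t.ef (show (1 : Fin 3) ≠ 2 by decide))
    have h₂ := (t.ff (show (0 : Fin 3) ≠ 2 by decide)).add_left
      (t.ff (show (1 : Fin 3) ≠ 2 by decide))
    have h₃ := (t.hf (show (0 : Fin 3) ≠ 2 by decide)).add_left
      (t.hf (show (1 : Fin 3) ≠ 2 by decide))
    exact ((h₂.mul_left h₁).add_left (h₃.smul_left _)).add_left ((h₃.pow_left 2).smul_left _)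
  · exact (LinearMap.ext t.triple₁₂.h_triCasimir).symm
  · have h₁ := (t.he (show (2 : Fin 3) ≠ 0 by decide)).symm.add_left
      (t.he (show (2 : Fin 3) ≠ 1 by decide)).symm
    have h₂ := (t.hf (show (2 : Fin 3) ≠ 0 by decide)).symm.add_left
      (t.hf (show (2 : Fin 3) ≠ 1 by decide)).symm
    have h₃ := (t.hh (show (0 : Fin 3) ≠ 2 by decide)).add_left
      (t.hh (show (1 : Fin 3) ≠ 2 by decide))
    exact ((h₂.mul_left h₁).add_left (h₃.smul_left _)).add_left ((h₃.pow_left 2).smul_left _)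

theorem commute_cas₂₃ (t : CommutingTriples n e f h Ω) :
    Commute (cas₂₃ e f h) (diag e) ∧ Commute (cas₂₃ e f h) (diag f) ∧
    Commute (cas₂₃ e f h) (diag h) := by
  simp only [diag, add_assoc]
  refine ⟨Commute.add_right ?_ ?_, Commute.add_right ?_ ?_, Commute.add_right ?_ ?_⟩
  · have h₁ := (t.ee (show (1 : Fin 3) ≠ 0 by decide)).add_left
      (t.ee (show (2 : Fin 3) ≠ 0 by decide))
    have h₂ := (t.ef (show (0 : Fin 3) ≠ 1 by decide)).symm.add_left
      (t.ef (show (0 : Fin 3) ≠ 2 by decide)).symm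
    have h₃ := (t.he (show (1 : Fin 3) ≠ 0 by decide)).add_left
      (t.he (show (2 : Fin 3) ≠ 0 by decide))
    exact ((h₂.mul_left h₁).add_left (h₃.smul_left _)).add_left ((h₃.pow_left 2).smul_left _)
  · exact (LinearMap.ext t.triple₂₃.e_triCasimir).symm
  · have h₁ := (t.ef (show (1 : Fin 3) ≠ 0 by decide)).add_left
      (t.ef (show (2 : Fin 3) ≠ 0 by decide))
    have h₂ := (t.ff (show (1 : Fin 3) ≠ 0 by decide)).add_left
      (t.ff (show (2 : Fin 3) ≠ 0 by decide))
    have h₃ := (t.hf (show (1 : Fin 3) ≠ 0 by decide)).add_left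
      (t.hf (show (2 : Fin 3) ≠ 0 by decide))
    exact ((h₂.mul_left h₁).add_left (h₃.smul_left _)).add_left ((h₃.pow_left 2).smul_left _)
  · exact (LinearMap.ext t.triple₂₃.f_triCasimir).symm
  · have h₁ := (t.he (show (0 : Fin 3) ≠ 1 by decide)).symm.add_left
      (t.he (show (0 : Fin 3) ≠ 2 by decide)).symm
    have h₂ := (t.hf (show (0 : Fin 3) ≠ 1 by decide)).symm.add_left
      (t.hf (show (0 : Fin 3) ≠ 2 by decide)).symm
    have h₃ := (t.hh (show (1 : Fin 3) ≠ 0 by decide)).add_left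
      (t.hh (show (2 : Fin 3) ≠ 0 by decide))
    exact ((h₂.mul_left h₁).add_left (h₃.smul_left _)).add_left ((h₃.pow_left 2).smul_left _)
  · exact (LinearMap.ext t.triple₂₃.h_triCasimir).symm

theorem commute_cas₁₂₃ (t : CommutingTriples n e f h Ω) :
    Commute (cas₁₂₃ e f h) (diag e) ∧ Commute (cas₁₂₃ e f h) (diag f) ∧
    Commute (cas₁₂₃ e f h) (diag h) :=
  ⟨(LinearMap.ext t.triple₁₂₃.e_triCasimir).symm, (LinearMap.ext t.triple₁₂₃.f_triCasimir).symm,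
    (LinearMap.ext t.triple₁₂₃.h_triCasimir).symm⟩

theorem apply_mem_hwSpace {K : Module.End ℂ V} (he : Commute K (diag e)) (hh : Commute K (diag h))
    {d : ℕ} {w : V} (hw : w ∈ hwSpace n e h d) : K w ∈ hwSpace n e h d := by
  rw [mem_hwSpace] at hw ⊢
  rw [← apply_apply_comm he, ← apply_apply_comm hh, hw.1, hw.2, map_zero, map_smul]
  exact ⟨rfl, rfl⟩

/-- By symmetry the Casimir may be moved to the monomial, where it produces the monomial (a,1,c).
Eliminating that one by `moment_sum` brings in (a,0,c+1) and cancels the excess diagonal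
coefficient: K₁₂ couples a + 1 only to a. -/
theorem moment_cas₁₂_succ (t : CommutingTriples n e f h Ω) {w : V} (hw : diag e w = 0) (a c : ℕ) :
    moment f Ω (cas₁₂ e f h w) (a + 1) 0 c =
      casVal (n 0 + n 1 - 2 * (a + 1 : ℕ)) * moment f Ω w (a + 1) 0 c -
        ((a : ℂ) + 1) * (n 0 - a) * moment f Ω w a 0 (c + 1) := by
  have h₁ : cas₁₂ e f h (mono f Ω (a + 1) 0 c) =
      (casVal (n 0 + n 1 - 2 * (a + 1 : ℕ)) + ((a : ℂ) + 1) * (n 0 - a)) • mono f Ω (a + 1) 0 c +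
        (((a : ℂ) + 1) * (n 0 - a)) • mono f Ω a 1 c := by
    obtain ⟨h₀, h₁, -⟩ := t.h_mono (a + 1) 0 c
    obtain ⟨f₀, f₁, -⟩ := t.f_mono a 0 c
    simp only [cas₁₂, triCasimir_apply, LinearMap.add_apply, map_add, map_smul, h₀, h₁, f₀, f₁,
      t.e₀_mono, (t.e_mono_zero (a + 1) 0 c).2.1, smul_add, map_zero, casVal]
    push_cast
    module
  have h₂ := t.triple₁₂.inner_triCasimir (mono f Ω (a + 1) 0 c) w
  have h₃ := t.moment_sum hw a 0 c
  simp only [moment, zero_add] at h₃ ⊢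
  rw [cas₁₂, ← h₂, ← cas₁₂, h₁, inner_add_left, inner_smul_left, inner_smul_left]
  simp only [map_add, map_mul, map_sub, conj_casVal, map_natCast, map_one]
  linear_combination ((a : ℂ) + 1) * (n 0 - a) * h₃

theorem moment_cas₁₂_zero (t : CommutingTriples n e f h Ω) {w : V} (c : ℕ) :
    moment f Ω (cas₁₂ e f h w) 0 0 c = casVal (n 0 + n 1) * moment f Ω w 0 0 c := by
  have h₁ : cas₁₂ e f h (mono f Ω 0 0 c) = casVal (n 0 + n 1) • mono f Ω 0 0 c := by
    obtain ⟨h₀, h₁, -⟩ := t.h_mono 0 0 c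
    simp only [cas₁₂, triCasimir_apply, LinearMap.add_apply, map_add, map_smul, h₀, h₁,
      (t.e_mono_zero 0 0 c).2.1, (t.e_mono_zero 0 0 c).1, smul_add, map_zero, casVal]
    push_cast
    module
  have h₂ := t.triple₁₂.inner_triCasimir (mono f Ω 0 0 c) w
  simp only [moment]
  rw [cas₁₂, ← h₂, ← cas₁₂, h₁, inner_smul_left, conj_casVal]

/-- Mirror image of `moment_cas₁₂_succ`: K₂₃ couples a only to a + 1, so the two Casimirs are
bidiagonal in opposite directions. -/
theorem moment_cas₂₃_succ (t : CommutingTriples n e f h Ω) {w : V} (hw : diag e w = 0) (a c : ℕ) :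
    moment f Ω (cas₂₃ e f h w) a 0 (c + 1) =
      casVal (n 1 + n 2 - 2 * (c + 1 : ℕ)) * moment f Ω w a 0 (c + 1) -
        ((c : ℂ) + 1) * (n 2 - c) * moment f Ω w (a + 1) 0 c := by
  have h₁ : cas₂₃ e f h (mono f Ω a 0 (c + 1)) =
      (casVal (n 1 + n 2 - 2 * (c + 1 : ℕ)) + ((c : ℂ) + 1) * (n 2 - c)) • mono f Ω a 0 (c + 1) +
        (((c : ℂ) + 1) * (n 2 - c)) • mono f Ω a 1 c := by
    obtain ⟨-, h₁, h₂⟩ := t.h_mono a 0 (c + 1)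
    obtain ⟨-, f₁, f₂⟩ := t.f_mono a 0 c
    simp only [cas₂₃, triCasimir_apply, LinearMap.add_apply, map_add, map_smul, h₁, h₂, f₁, f₂,
      t.e₂_mono, (t.e_mono_zero a 0 (c + 1)).2.1, smul_add, map_zero, casVal]
    push_cast
    module
  have h₂ := t.triple₂₃.inner_triCasimir (mono f Ω a 0 (c + 1)) w
  have h₃ := t.moment_sum hw a 0 c
  simp only [moment, zero_add] at h₃ ⊢
  rw [cas₂₃, ← h₂, ← cas₂₃, h₁, inner_add_left, inner_smul_left, inner_smul_left]
  simp only [map_add, map_mul, map_sub, conj_casVal, map_natCast, map_one]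
  linear_combination ((c : ℂ) + 1) * (n 2 - c) * h₃

/-- The lowest exponent `a = d - n 2` gives an eigenvector for the first Casimir operator. -/
theorem moment_cas₁₂_sub (t : CommutingTriples n e f h Ω) {w : V} {d : ℕ}
    (hw : w ∈ hwSpace n e h d) :
    moment f Ω (cas₁₂ e f h w) (d - n 2) 0 (d - (d - n 2)) =
      casVal (n 0 + n 1 - 2 * (d - n 2 : ℕ)) * moment f Ω w (d - n 2) 0 (d - (d - n 2)) := by
  -- Truncated subtraction makes d - n₂ the least a for which (a,0,d-a) can have a nonzero moment.
  -- If it is 0 there is no lower neighbour; otherwise the neighbour has third exponent n₂ + 1 and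
  -- its moment vanishes.
  rcases Nat.eq_zero_or_eq_succ_pred (d - n 2) with h₀ | h₀
  · rw [h₀, t.moment_cas₁₂_zero]; simp
  · rw [h₀, Nat.succ_eq_add_one, t.moment_cas₁₂_succ (mem_hwSpace.mp hw).1,
      t.moment_eq_zero (a := (d - n 2).pred) (c := _ + 1) (by right; right; omega),
      mul_zero, sub_zero]

/-- The eigenspace of the first Casimir operator for the lowest exponent is at most a line. -/
theorem eq_zero_of_cas₁₂ (t : CommutingTriples n e f h Ω) {w : V} {d : ℕ} (hw : w ∈ hwSpace n e h d)
    (hK : cas₁₂ e f h w = casVal (n 0 + n 1 - 2 * (d - n 2 : ℕ)) • w)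
    (h₀ : moment f Ω w (d - n 2) 0 (d - (d - n 2)) = 0) : w = 0 := by
  by_contra hne
  -- This gives d - n₂ ≤ n₁, which with a + 1 ≤ n₀ excludes the second root in `casVal_eq_iff` and
  -- so makes the eigenvalues along the recursion distinct.
  have hd := t.le_of_ne_zero hw hne
  refine hne (t.eq_zero_of_moment₁ hw fun a => ?_)
  induction a with
  | zero =>
    intro c hc
    by_cases hc' : n 2 < c
    · exact t.moment_eq_zero (by omega)
    · rwa [show d - n 2 = 0 by omega, show d - 0 = c by omega] at h₀
  | succ a ih =>
    intro c hc
    rcases lt_trichotomy (a + 1) (d - n 2) with hlt | heq | hgt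
    · exact t.moment_eq_zero (by omega)
    · rwa [← heq, show d - (a + 1) = c by omega] at h₀
    · by_cases ha : n 0 < a + 1
      · exact t.moment_eq_zero (by omega)
      · have h₁ := t.moment_cas₁₂_succ (mem_hwSpace.mp hw).1 a c
        rw [ih (c + 1) (by omega), hK, moment, inner_smul_right, ← moment, mul_zero, sub_zero] at h₁
        by_contra hm
        have := mul_right_cancel₀ hm h₁
        rw [casVal_eq_iff] at this
        omega

/-- The lowest exponent is cyclic for the second Casimir operator. -/
theorem eq_zero_of_cas₂₃_pow (t : CommutingTriples n e f h Ω) {w : V} {d : ℕ}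
    (hw : w ∈ hwSpace n e h d)
    (h₀ : ∀ r : ℕ, moment f Ω ((cas₂₃ e f h ^ r) w) (d - n 2) 0 (d - (d - n 2)) = 0) : w = 0 := by
  -- The induction quantifies over w because passing from k to k + 1 uses the hypothesis for both w
  -- and K₂₃ w.
  suffices ∀ k : ℕ, ∀ w ∈ hwSpace n e h d,
      (∀ r : ℕ, moment f Ω ((cas₂₃ e f h ^ r) w) (d - n 2) 0 (d - (d - n 2)) = 0) →
      ∀ a c, a = d - n 2 + k → a + c = d → moment f Ω w a 0 c = 0 by
    refine t.eq_zero_of_moment₁ hw fun a c hac => ?_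
    by_cases hc : n 2 < c
    · exact t.moment_eq_zero (by omega)
    · exact this (a - (d - n 2)) w hw h₀ a c (by omega) hac
  intro k
  induction k with
  | zero =>
    rintro w - h₀ a c rfl hac
    simpa [show d - (d - n 2) = c by omega] using h₀ 0
  | succ k ih =>
    rintro w hw h₀ a c rfl hac
    have hK : cas₂₃ e f h w ∈ hwSpace n e h d :=
      apply_mem_hwSpace t.commute_cas₂₃.1 t.commute_cas₂₃.2.2 hw
    have h₁ := t.moment_cas₂₃_succ (mem_hwSpace.mp hw).1 (d - n 2 + k) c
    rw [ih w hw h₀ _ _ rfl (by omega), ih _ hK (fun r => ?_) _ _ rfl (by omega), mul_zero, zero_sub,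
      eq_comm, neg_eq_zero, mul_eq_zero, mul_eq_zero] at h₁
    -- The off-diagonal coefficient (c + 1)(n₂ - c) is nonzero: a lies strictly above d - n₂, hence
    -- c < n₂.
    · refine h₁.resolve_left (not_or.mpr ⟨Nat.cast_add_one_ne_zero c, ?_⟩)
      rw [sub_eq_zero, Nat.cast_inj]
      omega
    · rw [← Module.End.mul_apply, ← pow_succ]
      exact h₀ (r + 1)

end CommutingTriples

/-! ### Reduction to highest weight vectors and generation of the centralizer. -/

/-- An operator commuting with `e` and `f` is determined by its values on the kernel of `e`. -/
theorem UnitaryTriple.eq_zero_of_forall_ker {V : Type*} [NormedAddCommGroup V]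
    [InnerProductSpace ℂ V] [FiniteDimensional ℂ V] {e f h : Module.End ℂ V}
    (t : UnitaryTriple e f h) (he : IsNilpotent e) {N : Module.End ℂ V} (hNe : Commute N e)
    (hNf : Commute N f) (hN : ∀ w, e w = 0 → N w = 0) : N = 0 := by
  -- Since ker e is the orthogonal complement of range f, V = range f + ker e, and N kills the
  -- second summand. So N v = f(N y) for some y, and ‖N v‖² is the inner product of N y with e(N v)
  -- = 0.
  have hN₁ : ∀ v, e (N v) = 0 → N v = 0 := by
    intro v hv
    have hc := codisjoint_iff.mp (LinearMap.range f).isCompl_orthogonal.codisjoint ▸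
      Submodule.mem_top (x := v)
    obtain ⟨_, ⟨y, rfl⟩, z, hz, rfl⟩ := Submodule.mem_sup.mp hc
    have hz' : e z = 0 := by
      rw [Submodule.mem_orthogonal] at hz
      have := hz (f (e z)) ⟨_, rfl⟩
      rw [t.inner_f] at this
      exact inner_self_eq_zero.mp this
    rw [map_add, hN z hz', add_zero] at hv ⊢
    have hy : N (f y) = f (N y) := LinearMap.congr_fun hNf.eq y
    rw [← inner_self_eq_zero (𝕜 := ℂ)]
    conv_lhs => rw [hy, t.inner_f, ← hy, hv, inner_zero_right]
  have hN₂ : ∀ k : ℕ, ∀ v, (e ^ k) v = 0 → N v = 0 := by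
    intro k
    induction k with
    | zero => intro v hv; rw [pow_zero, Module.End.one_apply] at hv; rw [hv, map_zero]
    | succ k ih =>
      intro v hv
      refine hN₁ v ?_
      rw [← Module.End.mul_apply, ← hNe.eq]
      exact ih _ (by rwa [pow_succ] at hv)
  obtain ⟨k, hk⟩ := he
  exact LinearMap.ext fun v => hN₂ k v (by rw [hk, LinearMap.zero_apply])

namespace CommutingTriples

variable {V : Type*} [NormedAddCommGroup V] [InnerProductSpace ℂ V]
  {n : Fin 3 → ℕ} {e f h : Fin 3 → Module.End ℂ V} {Ω : V}

theorem hwSpace_le_ker (d : ℕ) : hwSpace n e h d ≤ LinearMap.ker (diag e) := inf_le_left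

/-- The restriction of an operator commuting with `e` to the kernel of `e`. -/
def kerRestrict {E : Module.End ℂ V} (K : Module.End ℂ V) (hK : Commute K E) :
    Module.End ℂ (LinearMap.ker E) :=
  K.restrict (p := LinearMap.ker E) (q := LinearMap.ker E) fun x hx => by
    rw [LinearMap.mem_ker] at hx ⊢
    rw [← apply_apply_comm hK, hx, map_zero]

@[simp]
theorem coe_kerRestrict {E : Module.End ℂ V} (K : Module.End ℂ V) (hK : Commute K E)
    (w : LinearMap.ker E) : (kerRestrict K hK w : V) = K w := rfl

/-- f_i^(n_i + 1) kills Ω and commutes with every f_j, so it kills all monomials; its adjoint then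
has image orthogonal to all of them. -/
theorem e_pow_eq_zero (t : CommutingTriples n e f h Ω) (i : Fin 3) : e i ^ (n i + 1) = 0 := by
  have hc : ∀ j, Commute (f i ^ (n i + 1)) (f j) := fun j => by
    rcases eq_or_ne i j with rfl | hij
    · exact (Commute.refl _).pow_left _
    · exact (t.ff hij).pow_left _
  have hadj : ∀ k : ℕ, ∀ x y, inner ℂ x ((e i ^ k) y) = inner ℂ ((f i ^ k) x) y := fun k => by
    induction k with
    | zero => intro x y; rfl
    | succ k ih =>
      intro x y
      rw [pow_succ' (e i), pow_succ (f i), Module.End.mul_apply, Module.End.mul_apply,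
        ← (t.triple i).inner_f, ih]
  refine LinearMap.ext fun w => t.total _ fun a b c => ?_
  rw [hadj, apply_apply_comm (((hc 0).pow_right a).mul_right ((hc 1).pow_right b)
      |>.mul_right ((hc 2).pow_right c)), t.f_Ω, map_zero, inner_zero_left]

theorem isNilpotent_diag_e (t : CommutingTriples n e f h Ω) : IsNilpotent (diag e) := by
  have hn : ∀ i, IsNilpotent (e i) := fun i => ⟨_, t.e_pow_eq_zero i⟩
  refine Commute.isNilpotent_add ?_ ((t.ee (by decide)).isNilpotent_add (hn 0) (hn 1)) (hn 2)
  exact (t.ee (by decide)).add_left (t.ee (by decide))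

theorem cas₁₂₃_of_mem (t : CommutingTriples n e f h Ω) {d : ℕ} {w : V}
    (hw : w ∈ hwSpace n e h d) :
    cas₁₂₃ e f h w = casVal (n 0 + n 1 + n 2 - 2 * d : ℤ) • w := by
  rw [mem_hwSpace] at hw
  rw [cas₁₂₃, t.triple₁₂₃.triCasimir_of_primitive hw.1, hw.2, map_smul, hw.2, casVal]
  module

variable [FiniteDimensional ℂ V]

/-- The symmetric operator H is diagonalizable on the invariant subspace ker E. A nonzero
eigenvector has some nonzero moment, and the weight of that monomial must equal its eigenvalue. -/
theorem ker_le_iSup_hwSpace (t : CommutingTriples n e f h Ω) :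
    LinearMap.ker (diag e) ≤ ⨆ d, hwSpace n e h d := by
  have hsym : (diag h).IsSymmetric := t.triple₁₂₃.inner_h
  have htop : ⨆ μ, (diag h).genEigenspace μ 1 = ⊤ := by
    have := hsym.orthogonalComplement_iSup_eigenspaces_eq_bot
    rwa [Submodule.orthogonal_eq_bot_iff] at this
  rw [Submodule.eq_iSup_inf_genEigenspace (f := diag h) (p := LinearMap.ker (diag e)) 1
    (fun x hx => t.triple₁₂₃.h_primitive hx) htop]
  refine iSup_le fun μ w hw => ?_
  have hμ : diag h w = μ • w := Module.End.mem_eigenspace_iff.mp hw.2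
  by_cases h₀ : w = 0
  · rw [h₀]; exact Submodule.zero_mem _
  have : ∃ a b c, moment f Ω w a b c ≠ 0 := by
    by_contra! hall
    exact h₀ (t.total w hall)
  obtain ⟨a, b, c, habc⟩ := this
  have hm := mul_right_cancel₀ habc (t.moment_weight hμ a b c)
  exact Submodule.mem_iSup_of_mem (a + b + c) (mem_hwSpace.mpr ⟨hw.1, by rw [hm, hμ]⟩)

/-- On highest weight vectors of a given weight, an operator that commutes with the three Casimir
operators is a scalar. -/
theorem exists_scalar (t : CommutingTriples n e f h Ω)
    {Y : Module.End ℂ (LinearMap.ker (diag e))}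
    (h₁₂ : Commute Y (kerRestrict _ t.commute_cas₁₂.1))
    (h₂₃ : Commute Y (kerRestrict _ t.commute_cas₂₃.1))
    (h₁₂₃ : Commute Y (kerRestrict _ t.commute_cas₁₂₃.1)) (d : ℕ) :
    ∃ x : ℂ, ∀ w : LinearMap.ker (diag e), (w : V) ∈ hwSpace n e h d → Y w = x • w := by
  by_cases htriv : ∃ w ∈ hwSpace n e h d, w ≠ 0
  swap
  · push Not at htriv
    refine ⟨0, fun w hw => ?_⟩
    rw [show w = 0 from Subtype.ext (htriv _ hw), map_zero, smul_zero]
  obtain ⟨w₀, hw₀, hne₀⟩ := htriv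
  have hwt := t.weight_nonneg_of_ne_zero hw₀ hne₀
  have hKY : ∀ {K : Module.End ℂ V} {hK : Commute K (diag e)}, Commute Y (kerRestrict K hK) →
      ∀ w, K (Y w) = Y (kerRestrict K hK w) := fun hY w =>
    congrArg Subtype.val (LinearMap.congr_fun hY.eq w).symm
  have hYmem : ∀ w : LinearMap.ker (diag e), (w : V) ∈ hwSpace n e h d →
      (Y w : V) ∈ hwSpace n e h d := by
    intro w hw
    -- Y preserves the eigenvalue of K₁₂₃, and on ker E this eigenvalue determines the nonnegative
    -- weight.
    refine mem_hwSpace.mpr ⟨(Y w).2, t.triple₁₂₃.weight_of_triCasimir hwt (Y w).2 ?_⟩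
    have : kerRestrict _ t.commute_cas₁₂₃.1 w =
        casVal (n 0 + n 1 + n 2 - 2 * d : ℤ) • w := Subtype.ext (t.cas₁₂₃_of_mem hw)
    have h₁ := hKY h₁₂₃ w
    rw [this, map_smul] at h₁
    exact h₁
  set W := hwSpace n e h d
  -- p represents on W the functional taking the lowest moment.
  set p : V := W.starProjection (mono f Ω (d - n 2) 0 (d - (d - n 2))) with hp
  have hpW : p ∈ W := Submodule.starProjection_apply_mem _ _
  have hpin : ∀ w ∈ W, inner ℂ p w = moment f Ω w (d - n 2) 0 (d - (d - n 2)) := by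
    intro w hw
    rw [hp, Submodule.inner_starProjection_left_eq_right, moment,
      Submodule.starProjection_eq_self_iff.mpr hw]
  have hKW : ∀ r : ℕ, ∀ w ∈ W, (cas₂₃ e f h ^ r) w ∈ W := fun r w hw =>
    apply_mem_hwSpace (t.commute_cas₂₃.1.pow_left r) (t.commute_cas₂₃.2.2.pow_left r) hw
  have hp₀ : p ≠ 0 := by
    intro hp₀
    refine hne₀ (t.eq_zero_of_cas₂₃_pow hw₀ fun r => ?_)
    rw [← hpin _ (hKW r w₀ hw₀), hp₀, inner_zero_left]
  -- K₁₂ is symmetric and preserves W, so the eigenfunctional equation `moment_cas₁₂_sub` becomes an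
  -- eigenvector equation for p.
  have hKp : cas₁₂ e f h p = casVal (n 0 + n 1 - 2 * (d - n 2 : ℕ)) • p := by
    have hK : ∀ w ∈ W, cas₁₂ e f h w ∈ W := fun w hw =>
      apply_mem_hwSpace t.commute_cas₁₂.1 t.commute_cas₁₂.2.2 hw
    rw [← sub_eq_zero, ← inner_self_eq_zero (𝕜 := ℂ)]
    set u := cas₁₂ e f h p - casVal (n 0 + n 1 - 2 * (d - n 2 : ℕ)) • p
    have hu : u ∈ W := W.sub_mem (hK _ hpW) (W.smul_mem _ hpW)
    rw [show inner ℂ u u = inner ℂ (cas₁₂ e f h p) u -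
      inner ℂ (casVal (n 0 + n 1 - 2 * (d - n 2 : ℕ)) • p) u from inner_sub_left _ _ _,
      cas₁₂, t.triple₁₂.inner_triCasimir, ← cas₁₂, inner_smul_left, conj_casVal, hpin _ hu,
      hpin _ (hK _ hu), t.moment_cas₁₂_sub hu, sub_self]
  set P : LinearMap.ker (diag e) := ⟨p, hwSpace_le_ker d hpW⟩
  -- Y p has the same K₁₂-eigenvalue as p. Subtracting its projection onto p leaves an eigenvector
  -- whose lowest moment is zero, hence the zero vector.
  obtain ⟨x, hx⟩ : ∃ x : ℂ, (Y P : V) = x • p := by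
    refine ⟨inner ℂ p (Y P : V) / inner ℂ p p, ?_⟩
    rw [← sub_eq_zero]
    have hmem : (Y P : V) - (inner ℂ p (Y P : V) / inner ℂ p p) • p ∈ W :=
      W.sub_mem (hYmem P hpW) (W.smul_mem _ hpW)
    refine t.eq_zero_of_cas₁₂ hmem ?_ ?_
    · have hK : kerRestrict _ t.commute_cas₁₂.1 P =
        casVal (n 0 + n 1 - 2 * (d - n 2 : ℕ)) • P := Subtype.ext hKp
      have h₁ := hKY h₁₂ P
      rw [hK, map_smul] at h₁
      rw [map_sub, map_smul, hKp, h₁, Submodule.coe_smul]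
      module
    · rw [← hpin _ hmem, inner_sub_right, inner_smul_right,
        div_mul_cancel₀ _ (inner_self_ne_zero.mpr hp₀), sub_self]
  refine ⟨x, ?_⟩
  -- U is the part of W on which Y is the scalar x; it contains K₂₃^r p for all r because Y commutes
  -- with K₂₃.
  let U : Submodule ℂ V := (LinearMap.ker (Y - x • 1)).map (LinearMap.ker (diag e)).subtype ⊓ W
  have hpU : ∀ r : ℕ, (cas₂₃ e f h ^ r) p ∈ U := by
    intro r
    refine ⟨⟨⟨(cas₂₃ e f h ^ r) p, hwSpace_le_ker d (hKW r p hpW)⟩, ?_, rfl⟩, hKW r p hpW⟩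
    rw [SetLike.mem_coe, LinearMap.mem_ker, LinearMap.sub_apply, sub_eq_zero]
    induction r with
    | zero => exact Subtype.ext hx
    | succ r ih =>
      refine Subtype.ext ?_
      have h₁ := hKY h₂₃ ⟨(cas₂₃ e f h ^ r) p, hwSpace_le_ker d (hKW r p hpW)⟩
      rw [ih] at h₁
      simp only [pow_succ' _ r]
      refine h₁.symm.trans ?_
      exact map_smul (cas₂₃ e f h) x _
  have hWU : W ≤ U := by
    intro w hw
    have hc := codisjoint_iff.mp U.isCompl_orthogonal.codisjoint ▸ Submodule.mem_top (x := w)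
    obtain ⟨u, hu, z, hz, rfl⟩ := Submodule.mem_sup.mp hc
    have hzW : z ∈ W := by
      have := W.sub_mem hw hu.2
      rwa [add_sub_cancel_left] at this
    -- Moving K₂₃^r across the inner product, the lowest moment of K₂₃^r z is the inner product of
    -- K₂₃^r p ∈ U with z, which vanishes.
    have hz₀ : z = 0 := by
      refine t.eq_zero_of_cas₂₃_pow hzW fun r => ?_
      have hsym : ∀ r : ℕ, ∀ v w, inner ℂ v ((cas₂₃ e f h ^ r) w) =
          inner ℂ ((cas₂₃ e f h ^ r) v) w := fun r => by
        induction r with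
        | zero => intro v w; rfl
        | succ r ih =>
          intro v w
          rw [show (cas₂₃ e f h ^ (r + 1)) w = cas₂₃ e f h ((cas₂₃ e f h ^ r) w) by
            rw [pow_succ', Module.End.mul_apply], pow_succ, Module.End.mul_apply, ← ih]
          exact (t.triple₂₃.inner_triCasimir _ _).symm
      rw [← hpin _ (hKW r z hzW), hsym]
      exact (Submodule.mem_orthogonal _ _).mp hz _ (hpU r)
    rwa [hz₀, add_zero]
  intro w hw
  obtain ⟨⟨w', hw', hww'⟩, -⟩ := hWU hw
  rw [← Subtype.ext hww']
  rwa [SetLike.mem_coe, LinearMap.mem_ker, LinearMap.sub_apply, sub_eq_zero] at hw'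

/-- The three intermediate Casimir operators generate the centralizer of the diagonal action. -/
theorem mem_adjoin (t : CommutingTriples n e f h Ω) {M : Module.End ℂ V}
    (he : Commute M (diag e)) (hf : Commute M (diag f)) (hh : Commute M (diag h)) :
    M ∈ Algebra.adjoin ℂ {cas₁₂ e f h, cas₂₃ e f h, cas₁₂₃ e f h} := by
  have key : kerRestrict M he ∈ Algebra.adjoin ℂ {kerRestrict _ t.commute_cas₁₂.1,
      kerRestrict _ t.commute_cas₂₃.1, kerRestrict _ t.commute_cas₁₂₃.1} := by
    refine mem_adjoin_of_forall_commute ?_ ?_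
    · rintro T (rfl | rfl | rfl)
      · exact fun x y => t.triple₁₂.inner_triCasimir _ _
      · exact fun x y => t.triple₂₃.inner_triCasimir _ _
      · exact fun x y => t.triple₁₂₃.inner_triCasimir _ _
    · intro Y hY
      have hsc := t.exists_scalar (hY _ (by simp)) (hY _ (by simp)) (hY _ (by simp))
      refine LinearMap.ext fun w => ?_
      -- M preserves each weight space of highest weight vectors and Y is a scalar there, so the two
      -- commute on each, and these spaces span ker E.
      have : ∀ w ∈ ⨆ d, hwSpace n e h d, ∀ hw : w ∈ LinearMap.ker (diag e),
          (Y * kerRestrict M he) ⟨w, hw⟩ = (kerRestrict M he * Y) ⟨w, hw⟩ := by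
        intro w hw
        induction hw using Submodule.iSup_induction' with
        | mem d w hw' =>
          intro hw
          obtain ⟨x, hx⟩ := hsc d
          rw [Module.End.mul_apply, Module.End.mul_apply, hx ⟨w, hw⟩ hw', map_smul]
          exact hx _ (apply_mem_hwSpace he hh hw')
        | zero => intro hw; exact (map_zero (Y * kerRestrict M he)).trans (map_zero _).symm
        | add v w hv hw ihv ihw =>
          have hle : ⨆ d, hwSpace n e h d ≤ LinearMap.ker (diag e) := iSup_le hwSpace_le_ker
          intro _
          have := congrArg₂ (· + ·) (ihv (hle hv)) (ihw (hle hw))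
          rwa [← map_add, ← map_add] at this
      exact this w (t.ker_le_iSup_hwSpace w.2) w.2
  -- A polynomial in the restricted Casimirs is the restriction of the same polynomial in the
  -- Casimirs, which still commutes with E and F.
  have lift : ∀ r ∈ Algebra.adjoin ℂ {kerRestrict _ t.commute_cas₁₂.1,
      kerRestrict _ t.commute_cas₂₃.1, kerRestrict _ t.commute_cas₁₂₃.1},
      ∃ a ∈ Algebra.adjoin ℂ {cas₁₂ e f h, cas₂₃ e f h, cas₁₂₃ e f h}, Commute a (diag e) ∧
        Commute a (diag f) ∧ ∀ w : LinearMap.ker (diag e), a w = r w := by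
    intro r hr
    induction hr using Algebra.adjoin_induction with
    | mem r hr =>
      rcases hr with rfl | rfl | rfl
      · exact ⟨_, Algebra.subset_adjoin (by simp), t.commute_cas₁₂.1, t.commute_cas₁₂.2.1,
          fun _ => rfl⟩
      · exact ⟨_, Algebra.subset_adjoin (by simp), t.commute_cas₂₃.1, t.commute_cas₂₃.2.1,
          fun _ => rfl⟩
      · exact ⟨_, Algebra.subset_adjoin (by simp), t.commute_cas₁₂₃.1, t.commute_cas₁₂₃.2.1,
          fun _ => rfl⟩
    | algebraMap c =>
      exact ⟨algebraMap ℂ _ c, Subalgebra.algebraMap_mem _ c, Algebra.commutes c _,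
        Algebra.commutes c _, fun _ => rfl⟩
    | add r s _ _ hr hs =>
      obtain ⟨a, ha, hae, haf, haw⟩ := hr
      obtain ⟨b, hb, hbe, hbf, hbw⟩ := hs
      exact ⟨a + b, add_mem ha hb, hae.add_left hbe, haf.add_left hbf, fun w => by
        rw [LinearMap.add_apply, haw, hbw]; rfl⟩
    | mul r s _ _ hr hs =>
      obtain ⟨a, ha, hae, haf, haw⟩ := hr
      obtain ⟨b, hb, hbe, hbf, hbw⟩ := hs
      exact ⟨a * b, mul_mem ha hb, hae.mul_left hbe, haf.mul_left hbf, fun w => by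
        rw [Module.End.mul_apply, hbw, haw]; rfl⟩
  obtain ⟨a, ha, hae, haf, haw⟩ := lift _ key
  have : M - a = 0 := t.triple₁₂₃.eq_zero_of_forall_ker t.isNilpotent_diag_e (he.sub_left hae)
    (hf.sub_left haf) fun w hw => by
      rw [LinearMap.sub_apply, haw ⟨w, hw⟩, coe_kerRestrict, sub_self]
  rwa [sub_eq_zero.mp this]

end CommutingTriples

/-! ### From spin components to ladder operators. -/

open Racah

section Ladder

variable {R : Type*} [Ring R] [Algebra ℂ R]

/-- The raising operator `L^1 + i L^2`. -/
def raise (L : Fin 3 → R) : R := L 0 + Complex.I • L 1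

/-- The lowering operator `L^1 - i L^2`. -/
def lower (L : Fin 3 → R) : R := L 0 - Complex.I • L 1

/-- The weight operator `2 L^3`. -/
def weight (L : Fin 3 → R) : R := (2 : ℂ) • L 2

theorem raise_add (L M : Fin 3 → R) : raise (L + M) = raise L + raise M := by
  simp only [raise, Pi.add_apply, smul_add]; abel

theorem lower_add (L M : Fin 3 → R) : lower (L + M) = lower L + lower M := by
  simp only [lower, Pi.add_apply, smul_add]; abel

theorem weight_add (L M : Fin 3 → R) : weight (L + M) = weight L + weight M := by
  simp only [weight, Pi.add_apply, smul_add]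

theorem Racah.IsVectorOperator.of_lie {L : Fin 3 → R}
    (hL : ∀ a, L a * L (a + 1) - L (a + 1) * L a = Complex.I • L (a + 2)) :
    IsVectorOperator L L where
  same _ := rfl
  next a := by rw [← hL]; abel
  prev a := by rw [← hL]; abel

end Ladder

/-- (L₁ - iL₂)(L₁ + iL₂) = L₁² + L₂² - L₃, which accounts for the linear term h/2 with h = 2L₃. -/
theorem normSq_eq_triCasimir {V : Type*} [AddCommGroup V] [Module ℂ V]
    {L : Fin 3 → Module.End ℂ V} (hL : IsVectorOperator L L) :
    normSq L = triCasimir (raise L) (lower L) (weight L) := by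
  have h := hL.next 0
  simp only [zero_add] at h
  simp only [normSq, Fin.sum_univ_three, triCasimir, raise, lower, weight, pow_two, mul_add,
    sub_mul, smul_mul_assoc, mul_smul_comm, smul_smul, h]
  match_scalars <;> ring_nf <;> simp only [Complex.I_sq] <;> ring_nf

theorem unitaryTriple_of_isSymmetric {V : Type*} [NormedAddCommGroup V] [InnerProductSpace ℂ V]
    {L : Fin 3 → Module.End ℂ V} (hL : IsVectorOperator L L) (hs : ∀ a, (L a).IsSymmetric) :
    UnitaryTriple (raise L) (lower L) (weight L) := by
  have h₀ := fun v => LinearMap.congr_fun (hL.next 0) v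
  have h₁ := fun v => LinearMap.congr_fun (hL.next 1) v
  have h₂ := fun v => LinearMap.congr_fun (hL.next 2) v
  simp only [Fin.isValue, zero_add, Module.End.mul_apply, LinearMap.add_apply,
    LinearMap.smul_apply, show (1 : Fin 3) + 1 = 2 from rfl, show (1 : Fin 3) + 2 = 0 from rfl,
    show (2 : Fin 3) + 1 = 0 from rfl, show (2 : Fin 3) + 2 = 1 from rfl] at h₀ h₁ h₂
  constructor
  · intro v
    simp only [raise, lower, weight, LinearMap.add_apply, LinearMap.sub_apply,
      LinearMap.smul_apply, map_add, map_sub, map_smul, h₀]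
    match_scalars <;> ring_nf <;> simp only [Complex.I_sq] <;> ring_nf
  · intro v
    simp only [raise, weight, LinearMap.add_apply, LinearMap.smul_apply, map_add, map_smul, h₂, h₁]
    match_scalars <;> ring_nf <;> simp only [Complex.I_sq] <;> ring_nf
  · intro v
    simp only [lower, weight, LinearMap.sub_apply, LinearMap.smul_apply, map_sub, map_smul, h₂, h₁]
    match_scalars <;> ring_nf <;> simp only [Complex.I_sq] <;> ring_nf
  · intro v w
    simp only [raise, lower, LinearMap.add_apply, LinearMap.sub_apply, LinearMap.smul_apply,
      inner_add_left, inner_sub_right, inner_smul_left, inner_smul_right,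
        (hs _) v w, Complex.conj_I]
    ring

/-- Spin operators `L` with a cyclic highest weight vector `Ω` of weight `n`. -/
structure IsSpinVector {V : Type*} [AddCommGroup V] [Module ℂ V] (n : ℕ)
    (L : Fin 3 → Module.End ℂ V) (Ω : V) : Prop where
  raise_eq : raise L Ω = 0
  weight_eq : weight L Ω = (n : ℂ) • Ω
  lower_pow : (lower L ^ (n + 1)) Ω = 0
  span_eq : Submodule.span ℂ (Set.range fun k : ℕ => (lower L ^ k) Ω) = ⊤

/-- On Ω the Casimir is n/2 + n²/4; it commutes with lowering, so the value spreads along the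
vectors that span the space. -/
theorem IsSpinVector.normSq_eq {V : Type*} [NormedAddCommGroup V] [InnerProductSpace ℂ V] {n : ℕ}
    {L : Fin 3 → Module.End ℂ V} {Ω : V} (hΩ : IsSpinVector n L Ω) (hL : IsVectorOperator L L)
    (hs : ∀ a, (L a).IsSymmetric) : normSq L = algebraMap ℂ _ (casimirValue n) := by
  have t := unitaryTriple_of_isSymmetric hL hs
  rw [normSq_eq_triCasimir hL]
  refine LinearMap.ext_on_range hΩ.span_eq fun k => ?_
  have hc : Commute (triCasimir (raise L) (lower L) (weight L)) (lower L) :=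
    (LinearMap.ext t.f_triCasimir).symm
  rw [CommutingTriples.apply_apply_comm (hc.pow_right k), t.triCasimir_of_primitive hΩ.raise_eq,
    hΩ.weight_eq, map_smul, hΩ.weight_eq, Module.algebraMap_end_apply, ← map_smul, casimirValue]
  congr 1
  module

/-! ### Highest weight structure of the spin representations. -/

namespace su2

variable (V : Type*) [AddCommGroup V] [Module ℂ V] [LieRingModule su2 V] [LieModule ℂ su2 V]

/-- The spin operators of a representation. -/
def ops (a : Fin 3) : Module.End ℂ V := LieModule.toEnd ℂ su2 V (s a)

theorem isVectorOperator_ops : IsVectorOperator (ops V) (ops V) :=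
  .of_lie fun a => LinearMap.ext fun v => by
    change ⁅s a, ⁅s (a + 1), v⁆⁆ - ⁅s (a + 1), ⁅s a, v⁆⁆ = Complex.I • ⁅s (a + 2), v⁆
    rw [← lie_lie, s_lie_s, smul_lie]

theorem lie_lie_s (a : Fin 3) : ⁅s (a + 1), s a⁆ = -(Complex.I • s (a + 2)) := by
  rw [← s_lie_s, lie_skew]

theorem isSl2Triple : IsSl2Triple ((2 : ℂ) • s 2) (s 0 + Complex.I • s 1)
    (s 0 - Complex.I • s 1) := by
  have h₀ := s_lie_s 0
  have h₁ := s_lie_s 1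
  have h₂ := s_lie_s 2
  have g₀ := lie_lie_s 0
  have g₁ := lie_lie_s 1
  simp only [Fin.isValue, zero_add, show (1 : Fin 3) + 1 = 2 from rfl,
    show (1 : Fin 3) + 2 = 0 from rfl, show (2 : Fin 3) + 1 = 0 from rfl,
    show (2 : Fin 3) + 2 = 1 from rfl] at h₀ h₁ h₂ g₀ g₁
  constructor
  · intro h
    have := congrArg (fun x : su2 => x.1 0 0) h
    simp [s] at this
  · simp only [lie_sub, add_lie, lie_smul, smul_lie, lie_self, h₀, g₀, smul_neg, smul_smul]
    match_scalars <;> ring_nf <;> simp only [Complex.I_sq] <;> ring_nf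
  · simp only [lie_add, lie_smul, smul_lie, h₂, ← lie_skew (s 2) (s 1), h₁, smul_neg, smul_smul]
    match_scalars <;> ring_nf <;> simp only [Complex.I_sq] <;> ring_nf
  · simp only [lie_sub, lie_smul, smul_lie, h₂, ← lie_skew (s 2) (s 1), h₁, smul_neg, smul_smul]
    match_scalars <;> ring_nf <;> simp only [Complex.I_sq] <;> ring_nf

theorem toEnd_raise : LieModule.toEnd ℂ su2 V (s 0 + Complex.I • s 1) = raise (ops V) := by
  simp [raise, ops]

theorem toEnd_lower : LieModule.toEnd ℂ su2 V (s 0 - Complex.I • s 1) = lower (ops V) := by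
  simp [lower, ops]

theorem toEnd_weight : LieModule.toEnd ℂ su2 V ((2 : ℂ) • s 2) = weight (ops V) := by
  simp [weight, ops]

theorem lie_mem_of_forall {U : Submodule ℂ V} (hr : ∀ u ∈ U, raise (ops V) u ∈ U)
    (hl : ∀ u ∈ U, lower (ops V) u ∈ U) (hw : ∀ u ∈ U, weight (ops V) u ∈ U) (x : su2)
    {u : V} (hu : u ∈ U) : ⁅x, u⁆ ∈ U := by
  have h₀ : ops V 0 = (1 / 2 : ℂ) • (raise (ops V) + lower (ops V)) := by
    simp only [raise, lower]; module
  have h₁ : ops V 1 = (-Complex.I / 2 : ℂ) • (raise (ops V) - lower (ops V)) := by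
    simp only [raise, lower]
    match_scalars <;> ring_nf <;> simp only [Complex.I_sq] <;> ring_nf
  have h₂ : ops V 2 = (1 / 2 : ℂ) • weight (ops V) := by simp only [weight]; module
  have hops : ∀ a, ops V a u ∈ U := by
    intro a
    fin_cases a
    · simp only [Fin.zero_eta, h₀]
      exact U.smul_mem _ (U.add_mem (hr u hu) (hl u hu))
    · simp only [Fin.mk_one, h₁]
      exact U.smul_mem _ (U.sub_mem (hr u hu) (hl u hu))
    · simp only [Fin.reduceFinMk, h₂]
      exact U.smul_mem _ (hw u hu)
  have hx : x ∈ Submodule.span ℂ (Set.range s) := span_s ▸ Submodule.mem_top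
  induction hx using Submodule.span_induction with
  | mem x hx => obtain ⟨a, rfl⟩ := hx; exact hops a
  | zero => rw [zero_lie]; exact U.zero_mem
  | add x y _ _ hx hy => rw [add_lie]; exact U.add_mem hx hy
  | smul c x _ hx => rw [smul_lie]; exact U.smul_mem c hx

theorem exists_primitive [FiniteDimensional ℂ V] [Nontrivial V] :
    ∃ (v : V) (μ : ℂ), isSl2Triple.HasPrimitiveVectorWith v μ := by
  set H := LieModule.toEnd ℂ su2 V ((2 : ℂ) • s 2)
  obtain ⟨μ₀, hμ₀⟩ := Module.End.exists_eigenvalue H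
  -- An eigenvalue of largest real part: raising a corresponding eigenvector would give the
  -- eigenvalue μ + 2 unless the result is zero.
  obtain ⟨μ, hμ, hmax⟩ := Set.Finite.exists_maximalFor Complex.re
    {μ | H.HasEigenvalue μ} (Module.End.finite_hasEigenvalue H) ⟨μ₀, hμ₀⟩
  obtain ⟨v, hv⟩ := hμ.exists_hasEigenvector
  refine ⟨v, μ, hv.2, Module.End.mem_eigenspace_iff.mp hv.1, ?_⟩
  by_contra hne
  have : H.HasEigenvalue (μ + 2) := by
    refine Module.End.hasEigenvalue_of_hasEigenvector (x := ⁅s 0 + Complex.I • s 1, v⁆) ⟨?_, hne⟩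
    rw [Module.End.mem_eigenspace_iff]
    change ⁅(2 : ℂ) • s 2, ⁅s 0 + Complex.I • s 1, v⁆⁆ = _
    have hv' : ⁅(2 : ℂ) • s 2, v⁆ = μ • v := Module.End.mem_eigenspace_iff.mp hv.1
    rw [leibniz_lie, isSl2Triple.lie_h_e_smul ℂ, hv', lie_smul, smul_lie]
    module
  have := hmax this (by simp)
  simp at this
  linarith

end su2

namespace IsSpinRep

variable {n : ℕ} {V : Type*} [AddCommGroup V] [Module ℂ V] [LieRingModule su2 V]
  [LieModule ℂ su2 V]

theorem finiteDimensional (hV : IsSpinRep n V) : FiniteDimensional ℂ V :=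
  Module.finite_of_finrank_pos (by rw [hV.finrank_eq]; omega)

/-- A spin representation has a cyclic highest weight vector, and the vectors obtained from it by
lowering form a basis. -/
theorem exists_isSpinVector (hV : IsSpinRep n V) : ∃ Ω : V, IsSpinVector n (su2.ops V) Ω ∧
    LinearIndependent ℂ (fun k : Fin (n + 1) => (lower (su2.ops V) ^ (k : ℕ)) Ω) ∧
    (∀ k : ℕ, raise (su2.ops V) ((lower (su2.ops V) ^ (k + 1)) Ω) =
      (((k : ℂ) + 1) * (n - k)) • (lower (su2.ops V) ^ k) Ω) ∧
    ∀ k : ℕ, weight (su2.ops V) ((lower (su2.ops V) ^ k) Ω) =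
      ((n : ℂ) - 2 * k) • (lower (su2.ops V) ^ k) Ω := by
  have := hV.finiteDimensional
  have : Nontrivial V := Module.nontrivial_of_finrank_pos (R := ℂ) (by rw [hV.finrank_eq]; omega)
  have := hV.irreducible
  obtain ⟨v, μ, P⟩ := su2.exists_primitive V
  obtain ⟨m, rfl⟩ := P.exists_nat
  have hpow := P.pow_toEnd_f_eq_zero_of_eq_nat rfl
  have hr := P.lie_e_pow_succ_toEnd_f
  have hw := P.lie_h_pow_toEnd_f
  have hne := fun i => P.pow_toEnd_f_ne_zero_of_eq_nat rfl (i := i)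
  have hv₀ := P.ne_zero
  have hr₀ : raise (su2.ops V) v = 0 := by rw [← su2.toEnd_raise]; exact P.lie_e
  have hw₀ : weight (su2.ops V) v = (m : ℂ) • v := by rw [← su2.toEnd_weight]; exact P.lie_h
  simp only [← LieModule.toEnd_apply_apply ℂ su2 V, su2.toEnd_raise, su2.toEnd_lower,
    su2.toEnd_weight] at hpow hr hw hne
  set F := lower (su2.ops V)
  -- The span of the lowered vectors is stable under raising, lowering and weight, hence a nonzero
  -- Lie submodule; irreducibility makes it everything.
  have hspan : Submodule.span ℂ (Set.range fun k : ℕ => (F ^ k) v) = ⊤ := by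
    set U := Submodule.span ℂ (Set.range fun k : ℕ => (F ^ k) v)
    have hU : ∀ k : ℕ, (F ^ k) v ∈ U := fun k => Submodule.subset_span ⟨k, rfl⟩
    have hmap : ∀ T : Module.End ℂ V, (∀ k : ℕ, T ((F ^ k) v) ∈ U) → ∀ u ∈ U, T u ∈ U := by
      intro T hT
      refine Submodule.span_le (p := U.comap T) |>.mpr ?_
      rintro _ ⟨k, rfl⟩
      exact hT k
    let N : LieSubmodule ℂ su2 V :=
      { U with
        lie_mem := fun {x u} hu => su2.lie_mem_of_forall V
          (hmap _ fun k => by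
            cases k with
            | zero => rw [pow_zero, Module.End.one_apply, hr₀]; exact U.zero_mem
            | succ k => rw [hr]; exact U.smul_mem _ (hU k))
          (hmap _ fun k => by rw [← Module.End.mul_apply, ← pow_succ']; exact hU _)
          (hmap _ fun k => by rw [hw]; exact U.smul_mem _ (hU k)) x hu }
    have hN : N = ⊤ := by
      have hvN : v ∈ N := hU 0
      have : Nontrivial N := ⟨⟨v, hvN⟩, 0, fun h => hv₀ (congrArg Subtype.val h)⟩
      exact LieSubmodule.eq_top_of_isIrreducible ℂ su2 V N
    exact congrArg LieSubmodule.toSubmodule hN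
  have hli : LinearIndependent ℂ (fun k : Fin (m + 1) => (F ^ (k : ℕ)) v) := by
    refine Module.End.eigenvectors_linearIndependent' (weight (su2.ops V))
      (fun k : Fin (m + 1) => (m : ℂ) - 2 * (k : ℕ)) (fun i j hij => ?_) _ fun k => ⟨?_, ?_⟩
    · simpa [Fin.val_inj] using hij
    · exact Module.End.mem_eigenspace_iff.mpr (hw k)
    · exact hne k (by omega)
  have hspan' : Submodule.span ℂ (Set.range fun k : Fin (m + 1) => (F ^ (k : ℕ)) v) = ⊤ := by
    rw [eq_top_iff, ← hspan, Submodule.span_le]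
    rintro _ ⟨k, rfl⟩
    by_cases hk : k < m + 1
    · exact Submodule.subset_span ⟨⟨k, hk⟩, rfl⟩
    · obtain ⟨j, rfl⟩ := Nat.exists_eq_add_of_le (not_lt.mp hk)
      dsimp only
      rw [add_comm _ j, pow_add, Module.End.mul_apply, hpow, map_zero]
      exact Submodule.zero_mem _
  -- The lowered vectors form a basis of m + 1 elements, and the dimension is n + 1.
  have hmn : m = n := by
    have := finrank_span_eq_card hli
    rw [hspan', finrank_top, hV.finrank_eq, Fintype.card_fin] at this
    omega
  subst hmn
  exact ⟨v, ⟨hr₀, hw₀, hpow, hspan⟩, hli, hr, hw⟩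

end IsSpinRep

/-! ### Invariant inner products on the spin representations. -/

/-- The squared norm of `f^k Ω` when `Ω` is a unit highest weight vector of weight `n`. -/
def lowerNorm (n k : ℕ) : ℝ := ∏ j ∈ Finset.range k, ((j : ℝ) + 1) * (n - j)

theorem lowerNorm_succ (n k : ℕ) : lowerNorm n (k + 1) = lowerNorm n k * ((k + 1) * (n - k)) :=
  Finset.prod_range_succ _ _

theorem lowerNorm_pos {n k : ℕ} (hk : k ≤ n) : 0 < lowerNorm n k := by
  refine Finset.prod_pos fun j hj => ?_
  have : (j : ℝ) < n := by exact_mod_cast (Finset.mem_range.mp hj).trans_le hk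
  exact mul_pos (by positivity) (by linarith)

theorem lowerNorm_eq_zero {n k : ℕ} (hk : n < k) : lowerNorm n k = 0 :=
  Finset.prod_eq_zero (Finset.mem_range.mpr hk) (by simp)

/-- The inner product for which a basis is orthogonal with prescribed positive square norms. -/
@[reducible]
def weightedCore {ι V : Type*} [Fintype ι] [AddCommGroup V] [Module ℂ V] (b : Module.Basis ι ℂ V)
    (N : ι → ℝ) (hN : ∀ i, 0 < N i) : InnerProductSpace.Core ℂ V where
  inner x y := ∑ i, (N i : ℂ) * (starRingEnd ℂ (b.repr x i) * b.repr y i)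
  conj_inner_symm x y := by
    simp only [map_sum, map_mul, Complex.conj_conj, Complex.conj_ofReal]
    exact Finset.sum_congr rfl fun i _ => by ring
  re_inner_nonneg x := by
    simp only [← Complex.normSq_eq_conj_mul_self, ← Complex.ofReal_mul, ← Complex.ofReal_sum]
    exact Finset.sum_nonneg fun i _ => mul_nonneg (hN i).le (Complex.normSq_nonneg _)
  add_left x y z := by
    simp only [map_add, Finsupp.add_apply, ← Finset.sum_add_distrib]
    exact Finset.sum_congr rfl fun i _ => by ring
  smul_left x y r := by
    simp only [map_smul, Finsupp.smul_apply, smul_eq_mul, map_mul, Finset.mul_sum]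
    exact Finset.sum_congr rfl fun i _ => by ring
  definite x hx := by
    simp only [← Complex.normSq_eq_conj_mul_self, ← Complex.ofReal_mul, ← Complex.ofReal_sum,
      Complex.ofReal_eq_zero] at hx
    rw [Finset.sum_eq_zero_iff_of_nonneg
      fun i _ => mul_nonneg (hN i).le (Complex.normSq_nonneg _)] at hx
    refine b.ext_elem fun i => ?_
    have := (mul_eq_zero.mp (hx i (Finset.mem_univ i))).resolve_left (hN i).ne'
    simpa using this

theorem weightedCore_inner_basis {ι V : Type*} [Fintype ι] [DecidableEq ι] [AddCommGroup V]
    [Module ℂ V] (b : Module.Basis ι ℂ V) (N : ι → ℝ) (hN : ∀ i, 0 < N i) (i j : ι) :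
    (weightedCore b N hN).inner (b i) (b j) = if i = j then (N i : ℂ) else 0 := by
  change ∑ k, (N k : ℂ) * (starRingEnd ℂ (b.repr (b i) k) * b.repr (b j) k) = _
  rw [Finset.sum_eq_single i]
  · rw [b.repr_self, b.repr_self, Finsupp.single_eq_same, Finsupp.single_apply]
    simp [eq_comm]
  · intro k _ hk
    rw [b.repr_self, Finsupp.single_eq_of_ne hk]
    simp
  · simp

theorem InnerProductSpace.Core.symm_of_span {V : Type*} [AddCommGroup V] [Module ℂ V]
    (c : InnerProductSpace.Core ℂ V) {s : Set V} (hs : Submodule.span ℂ s = ⊤)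
    {S T : Module.End ℂ V} (h : ∀ x ∈ s, ∀ y ∈ s, c.inner (S x) y = c.inner x (T y)) (x y : V) :
    c.inner (S x) y = c.inner x (T y) := by
  let _ : NormedAddCommGroup V := c.toNormedAddCommGroup
  let _ : InnerProductSpace ℂ V := InnerProductSpace.ofCore c.toCore
  change inner ℂ (S x) y = inner ℂ x (T y)
  have hx : x ∈ Submodule.span ℂ s := hs ▸ Submodule.mem_top
  have hy : y ∈ Submodule.span ℂ s := hs ▸ Submodule.mem_top
  induction hx using Submodule.span_induction with
  | mem x hx =>
    induction hy using Submodule.span_induction with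
    | mem y hy => exact h x hx y hy
    | zero => simp
    | add y z _ _ hy hz => rw [map_add, inner_add_right, inner_add_right, hy, hz]
    | smul r y _ hy => rw [map_smul, inner_smul_right, inner_smul_right, hy]
  | zero => simp
  | add x z _ _ hx hz => rw [map_add, inner_add_left, inner_add_left, hx, hz]
  | smul r x _ hx => rw [map_smul, inner_smul_left, inner_smul_left, hx]

/-- The lowered vectors form a basis that is orthogonal for an inner product in which the spin
operators are symmetric. -/
theorem IsSpinVector.exists_weightedCore {V : Type*} [AddCommGroup V] [Module ℂ V] {n : ℕ}
    {L : Fin 3 → Module.End ℂ V} {Ω : V} (hΩ : IsSpinVector n L Ω)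
    (hr : ∀ k : ℕ, raise L ((lower L ^ (k + 1)) Ω) =
      (((k : ℂ) + 1) * (n - k)) • (lower L ^ k) Ω)
    (hw : ∀ k : ℕ, weight L ((lower L ^ k) Ω) = ((n : ℂ) - 2 * k) • (lower L ^ k) Ω)
    (hli : LinearIndependent ℂ (fun k : Fin (n + 1) => (lower L ^ (k : ℕ)) Ω)) :
    ∃ (b : Module.Basis (Fin (n + 1)) ℂ V) (N : Fin (n + 1) → ℝ) (hN : ∀ k, 0 < N k),
      (∀ k, b k = (lower L ^ (k : ℕ)) Ω) ∧ ∀ a x y,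
        (weightedCore b N hN).inner (L a x) y = (weightedCore b N hN).inner x (L a y) := by
  have hzero : ∀ k, n < k → (lower L ^ k) Ω = 0 := by
    intro k hk
    obtain ⟨j, rfl⟩ := Nat.exists_eq_add_of_lt hk
    rw [show n + j + 1 = j + (n + 1) by omega, pow_add, Module.End.mul_apply, hΩ.lower_pow,
      map_zero]
  have hspan : ⊤ ≤ Submodule.span ℂ (Set.range fun k : Fin (n + 1) => (lower L ^ (k : ℕ)) Ω) := by
    rw [← hΩ.span_eq, Submodule.span_le]
    rintro _ ⟨k, rfl⟩
    by_cases hk : k < n + 1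
    · exact Submodule.subset_span ⟨⟨k, hk⟩, rfl⟩
    · dsimp only
      rw [hzero k (by omega)]
      exact Submodule.zero_mem _
  let b := Module.Basis.mk hli hspan
  let c := weightedCore b (fun k => lowerNorm n k) fun k => lowerNorm_pos (by omega)
  let _ : NormedAddCommGroup V := c.toNormedAddCommGroup
  let _ : InnerProductSpace ℂ V := InnerProductSpace.ofCore c.toCore
  -- Valid for all exponents, since beyond n both the vectors and `lowerNorm` vanish; this spares
  -- the adjointness check a boundary case.
  have hin : ∀ k l : ℕ, inner ℂ ((lower L ^ k) Ω) ((lower L ^ l) Ω) =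
      if k = l then (lowerNorm n k : ℂ) else 0 := by
    intro k l
    by_cases hk : n < k
    · rw [hzero k hk, inner_zero_left, lowerNorm_eq_zero hk]; simp
    by_cases hl : n < l
    · rw [hzero l hl, inner_zero_right, if_neg (by omega)]
    have := weightedCore_inner_basis b (fun k => lowerNorm n k)
      (fun k => lowerNorm_pos (by omega)) ⟨k, by omega⟩ ⟨l, by omega⟩
    simp only [b, Module.Basis.mk_apply, Fin.mk.injEq] at this
    exact this
  have hext : ∀ S T : Module.End ℂ V, (∀ k l : ℕ, inner ℂ (S ((lower L ^ k) Ω)) ((lower L ^ l) Ω) =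
      inner ℂ ((lower L ^ k) Ω) (T ((lower L ^ l) Ω))) →
      ∀ x y, inner ℂ (S x) y = inner ℂ x (T y) := by
    intro S T hST
    refine c.symm_of_span hΩ.span_eq ?_
    rintro _ ⟨k, rfl⟩ _ ⟨l, rfl⟩
    exact hST k l
  have hre : ∀ x y, inner ℂ (raise L x) y = inner ℂ x (lower L y) := by
    refine hext _ _ fun k l => ?_
    rw [← Module.End.mul_apply (lower L), ← pow_succ', hin]
    cases k with
    | zero =>
      rw [pow_zero, Module.End.one_apply, hΩ.raise_eq, inner_zero_left, if_neg (by omega)]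
    | succ k =>
      rw [hr, inner_smul_left, hin]
      by_cases hkl : k = l
      -- The recursion of `lowerNorm` is exactly the condition that raising be adjoint to lowering.
      · rw [if_pos hkl, if_pos (by omega), lowerNorm_succ]
        simp only [map_mul, map_add, map_sub, map_natCast, map_one]
        push_cast
        ring
      · rw [if_neg hkl, if_neg (by omega), mul_zero]
  have hlo : ∀ x y, inner ℂ (lower L x) y = inner ℂ x (raise L y) := fun x y => by
    rw [← inner_conj_symm, ← hre, inner_conj_symm]
  have hwe : ∀ x y, inner ℂ (weight L x) y = inner ℂ x (weight L y) := by
    refine hext _ _ fun k l => ?_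
    rw [hw, hw, inner_smul_left, inner_smul_right, hin]
    by_cases hkl : k = l
    · subst hkl; simp [Complex.conj_ofNat]
    · rw [if_neg hkl, mul_zero, mul_zero]
  have h₀ : L 0 = (1 / 2 : ℂ) • (raise L + lower L) := by
    simp only [raise, lower]; module
  have h₁ : L 1 = (-Complex.I / 2 : ℂ) • (raise L - lower L) := by
    simp only [raise, lower]
    match_scalars <;> ring_nf <;> simp only [Complex.I_sq] <;> ring_nf
  have h₂ : L 2 = (1 / 2 : ℂ) • weight L := by simp only [weight]; module
  have hmain : ∀ a x y, inner ℂ (L a x) y = inner ℂ x (L a y) := by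
    intro a x y
    fin_cases a
    · simp only [Fin.zero_eta, h₀, LinearMap.smul_apply, LinearMap.add_apply, inner_smul_left,
        inner_smul_right, inner_add_left, inner_add_right, hre, hlo]
      simp [Complex.conj_ofNat, add_comm]
    · simp only [Fin.mk_one, h₁, LinearMap.smul_apply, LinearMap.sub_apply, inner_smul_left,
        inner_smul_right, inner_sub_left, inner_sub_right, hre, hlo]
      simp [Complex.conj_ofNat]
      ring
    · simp only [Fin.reduceFinMk, h₂, LinearMap.smul_apply, inner_smul_left,
        inner_smul_right, hwe]
      simp [Complex.conj_ofNat]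
  exact
    ⟨b, fun k => lowerNorm n k, fun k => lowerNorm_pos (by omega), fun k => Module.Basis.mk_apply _ _ k, hmain⟩

theorem commute_ladder {R : Type*} [Ring R] [Algebra ℂ R] {L : Fin 3 → R} {x : R}
    (h : ∀ a, Commute (L a) x) :
    Commute (raise L) x ∧ Commute (lower L) x ∧ Commute (weight L) x :=
  ⟨(h 0).add_left ((h 1).smul_left _), (h 0).sub_left ((h 1).smul_left _), (h 2).smul_left _⟩

theorem commute_ladder_ladder {R : Type*} [Ring R] [Algebra ℂ R] {L M : Fin 3 → R}
    (h : ∀ a b, Commute (L a) (M b)) :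
    Commute (raise L) (raise M) ∧ Commute (raise L) (lower M) ∧ Commute (lower L) (lower M) ∧
      Commute (weight L) (raise M) ∧ Commute (weight L) (lower M) ∧
        Commute (weight L) (weight M) := by
  have hr := commute_ladder fun b => (commute_ladder fun a => h a b).1.symm
  have hl := commute_ladder fun b => (commute_ladder fun a => h a b).2.1.symm
  have hw := commute_ladder fun b => (commute_ladder fun a => h a b).2.2.symm
  exact ⟨hr.1.symm, hr.2.1.symm, hl.2.1.symm, hw.1.symm, hw.2.1.symm, hw.2.2.symm⟩

theorem Racah.IsVectorOperator.map {R S : Type*} [Ring R] [Algebra ℂ R] [Ring S] [Algebra ℂ S]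
    (ψ : R →ₐ[ℂ] S) {L v : Fin 3 → R} (h : IsVectorOperator L v) :
    IsVectorOperator (fun a => ψ (L a)) (fun a => ψ (v a)) where
  same a := by rw [← map_mul, h.same, map_mul]
  next a := by rw [← map_mul, h.next, map_add, map_mul, map_smul]
  prev a := by rw [← map_mul, h.prev, map_sub, map_mul, map_smul]

theorem ladder_map {R S : Type*} [Ring R] [Algebra ℂ R] [Ring S] [Algebra ℂ S]
    (ψ : R →ₐ[ℂ] S) (L : Fin 3 → R) : raise (fun a => ψ (L a)) = ψ (raise L) ∧
      lower (fun a => ψ (L a)) = ψ (lower L) ∧ weight (fun a => ψ (L a)) = ψ (weight L) := by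
  simp [raise, lower, weight]

theorem normSq_map {R S : Type*} [Ring R] [Algebra ℂ R] [Ring S] [Algebra ℂ S]
    (ψ : R →ₐ[ℂ] S) (L : Fin 3 → R) : normSq (fun a => ψ (L a)) = ψ (normSq L) := by
  simp [normSq]

/-! ### Spin operators and inner product on the triple tensor product. -/

section Tensor

variable {V₁ V₂ V₃ : Type*} [AddCommGroup V₁] [Module ℂ V₁] [AddCommGroup V₂] [Module ℂ V₂]
  [AddCommGroup V₃]
  [Module ℂ V₃]

variable (V₁ V₂ V₃) in
/-- Operators acting on the first tensor factor. -/
def onFirst : Module.End ℂ V₁ →ₐ[ℂ] Module.End ℂ (V₁ ⊗[ℂ] V₂ ⊗[ℂ] V₃) :=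
  (Module.End.rTensorAlgHom ℂ (V₁ ⊗[ℂ] V₂) V₃).comp (Module.End.rTensorAlgHom ℂ V₁ V₂)

variable (V₁ V₂ V₃) in
/-- Operators acting on the second tensor factor. -/
def onSecond : Module.End ℂ V₂ →ₐ[ℂ] Module.End ℂ (V₁ ⊗[ℂ] V₂ ⊗[ℂ] V₃) :=
  (Module.End.rTensorAlgHom ℂ (V₁ ⊗[ℂ] V₂) V₃).comp (Module.End.lTensorAlgHom ℂ V₂ V₁)

variable (V₁ V₂ V₃) in
/-- Operators acting on the third tensor factor. -/
def onThird : Module.End ℂ V₃ →ₐ[ℂ] Module.End ℂ (V₁ ⊗[ℂ] V₂ ⊗[ℂ] V₃) :=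
  Module.End.lTensorAlgHom ℂ V₃ (V₁ ⊗[ℂ] V₂)

@[simp]
theorem onFirst_tmul (T : Module.End ℂ V₁) (x : V₁) (y : V₂) (z : V₃) :
    onFirst V₁ V₂ V₃ T (x ⊗ₜ y ⊗ₜ z) = T x ⊗ₜ y ⊗ₜ z := rfl

@[simp]
theorem onSecond_tmul (T : Module.End ℂ V₂) (x : V₁) (y : V₂) (z : V₃) :
    onSecond V₁ V₂ V₃ T (x ⊗ₜ y ⊗ₜ z) = x ⊗ₜ T y ⊗ₜ z := rfl

@[simp]
theorem onThird_tmul (T : Module.End ℂ V₃) (x : V₁) (y : V₂) (z : V₃) :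
    onThird V₁ V₂ V₃ T (x ⊗ₜ y ⊗ₜ z) = x ⊗ₜ y ⊗ₜ T z := rfl

theorem commute_first_second (T : Module.End ℂ V₁) (U : Module.End ℂ V₂) :
    Commute (onFirst V₁ V₂ V₃ T) (onSecond V₁ V₂ V₃ U) :=
  TensorProduct.ext_threefold fun _ _ _ => rfl

theorem commute_first_third (T : Module.End ℂ V₁) (U : Module.End ℂ V₃) :
    Commute (onFirst V₁ V₂ V₃ T) (onThird V₁ V₂ V₃ U) :=
  TensorProduct.ext_threefold fun _ _ _ => rfl

theorem commute_second_third (T : Module.End ℂ V₂) (U : Module.End ℂ V₃) :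
    Commute (onSecond V₁ V₂ V₃ T) (onThird V₁ V₂ V₃ U) :=
  TensorProduct.ext_threefold fun _ _ _ => rfl

/-- The spin operators of the three tensor factors. -/
def tensorOps (L₁ : Fin 3 → Module.End ℂ V₁) (L₂ : Fin 3 → Module.End ℂ V₂)
    (L₃ : Fin 3 → Module.End ℂ V₃) : Fin 3 → Fin 3 → Module.End ℂ (V₁ ⊗[ℂ] V₂ ⊗[ℂ] V₃) :=
  ![fun a => onFirst V₁ V₂ V₃ (L₁ a), fun a => onSecond V₁ V₂ V₃ (L₂ a),
    fun a => onThird V₁ V₂ V₃ (L₃ a)]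

variable {L₁ : Fin 3 → Module.End ℂ V₁} {L₂ : Fin 3 → Module.End ℂ V₂}
  {L₃ : Fin 3 → Module.End ℂ V₃}

theorem tensorOps_commute {i j : Fin 3} (hij : i ≠ j) (a b : Fin 3) :
    Commute (tensorOps L₁ L₂ L₃ i a) (tensorOps L₁ L₂ L₃ j b) := by
  have h₁₂ := commute_first_second (V₃ := V₃) (L₁ a) (L₂ b)
  have h₁₃ := commute_first_third (V₂ := V₂) (L₁ a) (L₃ b)
  have h₂₃ := commute_second_third (V₁ := V₁) (L₂ a) (L₃ b)
  have h₂₁ := (commute_first_second (V₃ := V₃) (L₁ b) (L₂ a)).symm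
  have h₃₁ := (commute_first_third (V₂ := V₂) (L₁ b) (L₃ a)).symm
  have h₃₂ := (commute_second_third (V₁ := V₁) (L₂ b) (L₃ a)).symm
  fin_cases i <;> fin_cases j <;> first | exact absurd rfl hij | assumption

theorem tensorOps_isVectorOperator (h₁ : IsVectorOperator L₁ L₁) (h₂ : IsVectorOperator L₂ L₂)
    (h₃ : IsVectorOperator L₃ L₃) (i : Fin 3) :
    IsVectorOperator (tensorOps L₁ L₂ L₃ i) (tensorOps L₁ L₂ L₃ i) := by
  have h₁ := h₁.map (R := Module.End ℂ V₁)
    (S := Module.End ℂ (V₁ ⊗[ℂ] V₂ ⊗[ℂ] V₃)) (onFirst V₁ V₂ V₃)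
  have h₂ := h₂.map (R := Module.End ℂ V₂)
    (S := Module.End ℂ (V₁ ⊗[ℂ] V₂ ⊗[ℂ] V₃)) (onSecond V₁ V₂ V₃)
  have h₃ := h₃.map (R := Module.End ℂ V₃)
    (S := Module.End ℂ (V₁ ⊗[ℂ] V₂ ⊗[ℂ] V₃)) (onThird V₁ V₂ V₃)
  fin_cases i <;> assumption

theorem tensorOps_ladder (i : Fin 3) :
    raise (tensorOps L₁ L₂ L₃ i) = ![onFirst V₁ V₂ V₃ (raise L₁), onSecond V₁ V₂ V₃ (raise L₂),
      onThird V₁ V₂ V₃ (raise L₃)] i ∧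
    lower (tensorOps L₁ L₂ L₃ i) = ![onFirst V₁ V₂ V₃ (lower L₁), onSecond V₁ V₂ V₃ (lower L₂),
      onThird V₁ V₂ V₃ (lower L₃)] i ∧
    weight (tensorOps L₁ L₂ L₃ i) = ![onFirst V₁ V₂ V₃ (weight L₁), onSecond V₁ V₂ V₃ (weight L₂),
      onThird V₁ V₂ V₃ (weight L₃)] i := by
  have h₁ := ladder_map (R := Module.End ℂ V₁)
    (S := Module.End ℂ (V₁ ⊗[ℂ] V₂ ⊗[ℂ] V₃)) (onFirst V₁ V₂ V₃) L₁
  have h₂ := ladder_map (R := Module.End ℂ V₂)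
    (S := Module.End ℂ (V₁ ⊗[ℂ] V₂ ⊗[ℂ] V₃)) (onSecond V₁ V₂ V₃) L₂
  have h₃ := ladder_map (R := Module.End ℂ V₃)
    (S := Module.End ℂ (V₁ ⊗[ℂ] V₂ ⊗[ℂ] V₃)) (onThird V₁ V₂ V₃) L₃
  fin_cases i <;> assumption

/-- With product weights on the product basis the form factors on pure tensors, so symmetry of an
operator on one factor passes to the tensor product. -/
theorem weightedCore_inner_tmul {ι₁ ι₂ : Type*} [Fintype ι₁] [Fintype ι₂]
    (b₁ : Module.Basis ι₁ ℂ V₁) (b₂ : Module.Basis ι₂ ℂ V₂) {N₁ : ι₁ → ℝ} {N₂ : ι₂ → ℝ}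
    (hN₁ : ∀ i, 0 < N₁ i) (hN₂ : ∀ i, 0 < N₂ i) (x x' : V₁) (y y' : V₂) :
    (weightedCore (b₁.tensorProduct b₂) (fun p => N₁ p.1 * N₂ p.2)
      fun p => mul_pos (hN₁ p.1) (hN₂ p.2)).inner (x ⊗ₜ y) (x' ⊗ₜ y') =
      (weightedCore b₁ N₁ hN₁).inner x x' * (weightedCore b₂ N₂ hN₂).inner y y' := by
  change ∑ p : ι₁ × ι₂, _ = (∑ i, _) * ∑ j, _
  rw [Finset.sum_mul_sum, Fintype.sum_prod_type]
  refine Finset.sum_congr rfl fun i _ => Finset.sum_congr rfl fun j _ => ?_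
  simp only [Module.Basis.tensorProduct_repr_tmul_apply, smul_eq_mul, map_mul]
  push_cast
  ring

theorem tensorOps_symm {ι₁ ι₂ ι₃ : Type*} [Fintype ι₁] [Fintype ι₂] [Fintype ι₃]
    (b₁ : Module.Basis ι₁ ℂ V₁) (b₂ : Module.Basis ι₂ ℂ V₂) (b₃ : Module.Basis ι₃ ℂ V₃)
    {N₁ : ι₁ → ℝ} {N₂ : ι₂ → ℝ} {N₃ : ι₃ → ℝ}
    (hN₁ : ∀ i, 0 < N₁ i) (hN₂ : ∀ i, 0 < N₂ i) (hN₃ : ∀ i, 0 < N₃ i)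
    (s₁ : ∀ a x y, (weightedCore b₁ N₁ hN₁).inner (L₁ a x) y =
      (weightedCore b₁ N₁ hN₁).inner x (L₁ a y))
    (s₂ : ∀ a x y, (weightedCore b₂ N₂ hN₂).inner (L₂ a x) y =
      (weightedCore b₂ N₂ hN₂).inner x (L₂ a y))
    (s₃ : ∀ a x y, (weightedCore b₃ N₃ hN₃).inner (L₃ a x) y =
      (weightedCore b₃ N₃ hN₃).inner x (L₃ a y)) :
    ∃ c : InnerProductSpace.Core ℂ (V₁ ⊗[ℂ] V₂ ⊗[ℂ] V₃), ∀ i a u w,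
      c.inner (tensorOps L₁ L₂ L₃ i a u) w = c.inner u (tensorOps L₁ L₂ L₃ i a w) := by
  refine ⟨weightedCore ((b₁.tensorProduct b₂).tensorProduct b₃)
    (fun p => N₁ p.1.1 * N₂ p.1.2 * N₃ p.2)
    fun p => mul_pos (mul_pos (hN₁ _) (hN₂ _)) (hN₃ _), fun i a => ?_⟩
  refine InnerProductSpace.Core.symm_of_span _
    ((b₁.tensorProduct b₂).tensorProduct b₃).span_eq ?_
  rintro _ ⟨⟨⟨i₁, i₂⟩, i₃⟩, rfl⟩ _ ⟨⟨⟨j₁, j₂⟩, j₃⟩, rfl⟩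
  simp only [Module.Basis.tensorProduct_apply]
  have key : ∀ (x x' : V₁) (y y' : V₂) (z z' : V₃),
      (weightedCore ((b₁.tensorProduct b₂).tensorProduct b₃)
        (fun p => N₁ p.1.1 * N₂ p.1.2 * N₃ p.2)
        fun p => mul_pos (mul_pos (hN₁ _) (hN₂ _)) (hN₃ _)).inner (x ⊗ₜ y ⊗ₜ z) (x' ⊗ₜ y' ⊗ₜ z') =
      (weightedCore b₁ N₁ hN₁).inner x x' * (weightedCore b₂ N₂ hN₂).inner y y' *
        (weightedCore b₃ N₃ hN₃).inner z z' := fun x x' y y' z z' =>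
    (weightedCore_inner_tmul (b₁.tensorProduct b₂) b₃ (fun p => mul_pos (hN₁ p.1) (hN₂ p.2)) hN₃
      (x ⊗ₜ y) (x' ⊗ₜ y') z z').trans
        (congrArg (· * _) (weightedCore_inner_tmul b₁ b₂ hN₁ hN₂ x x' y y'))
  fin_cases i
  · exact (key _ _ _ _ _ _).trans (by rw [s₁]; exact (key _ _ _ _ _ _).symm)
  · exact (key _ _ _ _ _ _).trans (by rw [s₂]; exact (key _ _ _ _ _ _).symm)
  · exact (key _ _ _ _ _ _).trans (by rw [s₃]; exact (key _ _ _ _ _ _).symm)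

theorem tensorOps_Ω {n₁ n₂ n₃ : ℕ} {Ω₁ : V₁} {Ω₂ : V₂} {Ω₃ : V₃}
    (h₁ : IsSpinVector n₁ L₁ Ω₁) (h₂ : IsSpinVector n₂ L₂ Ω₂) (h₃ : IsSpinVector n₃ L₃ Ω₃)
    (i : Fin 3) : raise (tensorOps L₁ L₂ L₃ i) (Ω₁ ⊗ₜ Ω₂ ⊗ₜ Ω₃) = 0 ∧
      weight (tensorOps L₁ L₂ L₃ i) (Ω₁ ⊗ₜ Ω₂ ⊗ₜ Ω₃) =
        ((![n₁, n₂, n₃] i : ℕ) : ℂ) • Ω₁ ⊗ₜ Ω₂ ⊗ₜ Ω₃ ∧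
      (lower (tensorOps L₁ L₂ L₃ i) ^ (![n₁, n₂, n₃] i + 1)) (Ω₁ ⊗ₜ Ω₂ ⊗ₜ Ω₃) = 0 := by
  rw [(tensorOps_ladder i).1, (tensorOps_ladder i).2.1, (tensorOps_ladder i).2.2]
  fin_cases i
  · change raise L₁ Ω₁ ⊗ₜ Ω₂ ⊗ₜ Ω₃ = 0 ∧
      weight L₁ Ω₁ ⊗ₜ Ω₂ ⊗ₜ Ω₃ = (n₁ : ℂ) • Ω₁ ⊗ₜ Ω₂ ⊗ₜ Ω₃ ∧
      (onFirst V₁ V₂ V₃ (lower L₁) ^ (n₁ + 1)) (Ω₁ ⊗ₜ Ω₂ ⊗ₜ Ω₃) = 0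
    rw [← map_pow, onFirst_tmul, h₁.raise_eq, h₁.weight_eq, h₁.lower_pow]
    simp [TensorProduct.smul_tmul']
  · change Ω₁ ⊗ₜ raise L₂ Ω₂ ⊗ₜ Ω₃ = 0 ∧
      Ω₁ ⊗ₜ weight L₂ Ω₂ ⊗ₜ Ω₃ = (n₂ : ℂ) • Ω₁ ⊗ₜ Ω₂ ⊗ₜ Ω₃ ∧
      (onSecond V₁ V₂ V₃ (lower L₂) ^ (n₂ + 1)) (Ω₁ ⊗ₜ Ω₂ ⊗ₜ Ω₃) = 0
    rw [← map_pow, onSecond_tmul, h₂.raise_eq, h₂.weight_eq, h₂.lower_pow,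
      TensorProduct.tmul_smul, ← TensorProduct.smul_tmul' _ (Ω₁ ⊗ₜ Ω₂)]
    simp
  · change Ω₁ ⊗ₜ Ω₂ ⊗ₜ raise L₃ Ω₃ = 0 ∧
      Ω₁ ⊗ₜ Ω₂ ⊗ₜ weight L₃ Ω₃ = (n₃ : ℂ) • Ω₁ ⊗ₜ Ω₂ ⊗ₜ Ω₃ ∧
      (onThird V₁ V₂ V₃ (lower L₃) ^ (n₃ + 1)) (Ω₁ ⊗ₜ Ω₂ ⊗ₜ Ω₃) = 0
    rw [← map_pow, onThird_tmul, h₃.raise_eq, h₃.weight_eq, h₃.lower_pow, TensorProduct.tmul_smul]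
    simp

theorem tensorOps_mono (Ω₁ : V₁) (Ω₂ : V₂) (Ω₃ : V₃) (a b c : ℕ) :
    (lower (tensorOps L₁ L₂ L₃ 0) ^ a * lower (tensorOps L₁ L₂ L₃ 1) ^ b *
      lower (tensorOps L₁ L₂ L₃ 2) ^ c) (Ω₁ ⊗ₜ Ω₂ ⊗ₜ Ω₃) =
      (lower L₁ ^ a) Ω₁ ⊗ₜ (lower L₂ ^ b) Ω₂ ⊗ₜ (lower L₃ ^ c) Ω₃ := by
  rw [(tensorOps_ladder 0).2.1, (tensorOps_ladder 1).2.1, (tensorOps_ladder 2).2.1]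
  change (onFirst V₁ V₂ V₃ (lower L₁) ^ a * onSecond V₁ V₂ V₃ (lower L₂) ^ b *
    onThird V₁ V₂ V₃ (lower L₃) ^ c) _ = _
  rw [← map_pow, ← map_pow, ← map_pow, Module.End.mul_apply, Module.End.mul_apply,
    onThird_tmul, onSecond_tmul, onFirst_tmul]

end Tensor

/-! ### Generation of the centralizer in terms of spins. -/

/-- For three commuting spins acting on a space generated by a joint highest weight vector, the
intermediate Casimir operators generate the centralizer of the total spin. -/
theorem mem_adjoin_normSq {V : Type*} [AddCommGroup V] [Module ℂ V] [FiniteDimensional ℂ V]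
    (c : InnerProductSpace.Core ℂ V) {n : Fin 3 → ℕ} {T : Fin 3 → Fin 3 → Module.End ℂ V} {Ω : V}
    (hv : ∀ i, IsVectorOperator (T i) (T i))
    (hs : ∀ i a x y, c.inner (T i a x) y = c.inner x (T i a y))
    (hc : ∀ {i j}, i ≠ j → ∀ a b, Commute (T i a) (T j b))
    (hΩ : ∀ i, raise (T i) Ω = 0 ∧ weight (T i) Ω = (n i : ℂ) • Ω ∧
      (lower (T i) ^ (n i + 1)) Ω = 0)
    (hspan : Submodule.span ℂ {v | ∃ a b c : ℕ,
      v = (lower (T 0) ^ a * lower (T 1) ^ b * lower (T 2) ^ c) Ω} = ⊤)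
    {M : Module.End ℂ V} (hM : ∀ a, Commute ((T 0 + T 1 + T 2) a) M) :
    M ∈ Algebra.adjoin ℂ {normSq (T 0 + T 1), normSq (T 1 + T 2), normSq (T 0 + T 1 + T 2)} := by
  let _ : NormedAddCommGroup V := c.toNormedAddCommGroup
  let _ : InnerProductSpace ℂ V := InnerProductSpace.ofCore c.toCore
  have hs' : ∀ i a, (T i a).IsSymmetric := hs
  have t : CommutingTriples n (fun i => raise (T i)) (fun i => lower (T i))
      (fun i => weight (T i)) Ω := by
    constructor
    · exact fun i => unitaryTriple_of_isSymmetric (hv i) (hs' i)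
    · exact fun hij => (commute_ladder_ladder (hc hij)).1
    · exact fun hij => (commute_ladder_ladder (hc hij)).2.1
    · exact fun hij => (commute_ladder_ladder (hc hij)).2.2.1
    · exact fun hij => (commute_ladder_ladder (hc hij)).2.2.2.1
    · exact fun hij => (commute_ladder_ladder (hc hij)).2.2.2.2.1
    · exact fun hij => (commute_ladder_ladder (hc hij)).2.2.2.2.2
    · exact fun i => (hΩ i).1
    · exact fun i => (hΩ i).2.1
    · exact fun i => (hΩ i).2.2
    · intro w hw
      rw [← inner_self_eq_zero (𝕜 := ℂ)]
      have hall : ∀ u ∈ Submodule.span ℂ {v | ∃ a b c : ℕ,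
          v = (lower (T 0) ^ a * lower (T 1) ^ b * lower (T 2) ^ c) Ω}, inner ℂ u w = 0 := by
        intro u hu
        induction hu using Submodule.span_induction with
        | mem u hu => obtain ⟨a, b, c, rfl⟩ := hu; exact hw a b c
        | zero => exact inner_zero_left _
        | add x y _ _ hx hy => rw [inner_add_left, hx, hy, add_zero]
        | smul r x _ hx => rw [inner_smul_left, hx, mul_zero]
      exact hall w (hspan ▸ Submodule.mem_top)
  have hcm : ∀ {i j : Fin 3}, i ≠ j → ∀ a b, T i a * T j b = T j b * T i a :=
    fun hij a b => (hc hij a b).eq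
  have w₁₂ := (hv 0).add (hcm (by decide)) (hcm (by decide)) (hv 1)
  have w₂₃ := (hv 1).add (hcm (by decide)) (hcm (by decide)) (hv 2)
  have h₃ : ∀ a b, T 2 a * (T 0 + T 1) b = (T 0 + T 1) b * T 2 a := fun a b => by
    simp only [Pi.add_apply, mul_add, add_mul, hcm (show (2 : Fin 3) ≠ 0 by decide),
      hcm (show (2 : Fin 3) ≠ 1 by decide)]
  have w₁₂₃ := w₁₂.add h₃ (fun a b => (h₃ b a).symm) (hv 2)
  have key := commute_ladder hM
  simp only [raise_add, lower_add, weight_add] at key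
  rw [normSq_eq_triCasimir w₁₂, normSq_eq_triCasimir w₂₃, normSq_eq_triCasimir w₁₂₃]
  simp only [raise_add, lower_add, weight_add]
  exact t.mem_adjoin key.1.symm key.2.1.symm key.2.2.symm

/-- The inner product is auxiliary: it makes `IsSpinVector.normSq_eq` applicable and does not enter
the conclusion. -/
theorem IsSpinRep.normSq_ops {n : ℕ} {V : Type*} [AddCommGroup V] [Module ℂ V]
    [LieRingModule su2 V] [LieModule ℂ su2 V] (hV : IsSpinRep n V) :
    normSq (su2.ops V) = algebraMap ℂ _ (casimirValue n) := by
  obtain ⟨Ω, hΩ, hli, hr, hw⟩ := hV.exists_isSpinVector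
  obtain ⟨b, N, hN, -, hs⟩ := hΩ.exists_weightedCore hr hw hli
  let _ : NormedAddCommGroup V := (weightedCore b N hN).toNormedAddCommGroup
  let _ : InnerProductSpace ℂ V := InnerProductSpace.ofCore (weightedCore b N hN).toCore
  have hs' : ∀ a, (su2.ops V a).IsSymmetric := hs
  exact hΩ.normSq_eq (su2.isVectorOperator_ops V) hs'

/-- An algebra homomorphism out of the free algebra respects the Racah relations if the images of
the generators satisfy them. -/
theorem algHom_eq_of_rel {S : Type*} [Ring S] [Algebra ℂ S] (F : FreeAlgebra ℂ Gen →ₐ[ℂ] S)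
    (hα : ∀ i g, F (gen (.α i)) * F (gen g) = F (gen g) * F (gen (.α i)))
    (hC : ∀ g, F (gen .C) * F (gen g) = F (gen g) * F (gen .C))
    (hB : Racah.comm (F (gen .B)) (Racah.comm (F (gen .A)) (F (gen .B))) =
      -2 * F (gen .B) ^ 2 - 2 * acomm (F (gen .A)) (F (gen .B)) +
        2 * (F (gen .C) + F (gen (.α 0)) + F (gen (.α 1)) + F (gen (.α 2))) * F (gen .B) +
        2 * (F (gen (.α 0)) - F (gen .C)) * (F (gen (.α 2)) - F (gen (.α 1))))
    (hA : Racah.comm (F (gen .A)) (Racah.comm (F (gen .B)) (F (gen .A))) =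
      -2 * F (gen .A) ^ 2 - 2 * acomm (F (gen .A)) (F (gen .B)) +
        2 * (F (gen .C) + F (gen (.α 0)) + F (gen (.α 1)) + F (gen (.α 2))) * F (gen .A) +
        2 * (F (gen (.α 0)) - F (gen (.α 1))) * (F (gen (.α 2)) - F (gen .C)))
    {x y : FreeAlgebra ℂ Gen} (hxy : Rel x y) : F x = F y := by
  have h2 : F 2 = 2 := map_ofNat F 2
  have hc : ∀ x y, F (Racah.comm x y) = Racah.comm (F x) (F y) := fun x y => by
    rw [Racah.comm, map_sub, map_mul, map_mul, Racah.comm]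
  have ha : ∀ x y, F (acomm x y) = acomm (F x) (F y) := fun x y => by
    rw [acomm, map_add, map_mul, map_mul, acomm]
  have hp : ∀ x, F (x ^ 2) = F x ^ 2 := fun x => by rw [pow_two, map_mul, pow_two]
  cases hxy with
  | central_α i g => rw [map_mul, map_mul, hα]
  | central_C g => rw [map_mul, map_mul, hC]
  | relB => simp only [hc, ha, hp, map_sub, map_add, map_mul, map_neg, h2, hB]
  | relA => simp only [hc, ha, hp, map_sub, map_add, map_mul, map_neg, h2, hA]

/-- The right-hand side of the Racah relations is symmetric under exchanging the outer spins. -/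
theorem racah_rhs_swap {R : Type*} [Ring R] [Algebra ℂ R] (A B C : R) (a₁ a₂ a₃ : ℂ) :
    -2 * A ^ 2 - 2 * acomm B A +
        2 * (C + algebraMap ℂ R a₃ + algebraMap ℂ R a₂ + algebraMap ℂ R a₁) * A +
        2 * (algebraMap ℂ R a₃ - C) * (algebraMap ℂ R a₁ - algebraMap ℂ R a₂) =
      -2 * A ^ 2 - 2 * acomm A B +
        2 * (C + algebraMap ℂ R a₁ + algebraMap ℂ R a₂ + algebraMap ℂ R a₃) * A +
        2 * (algebraMap ℂ R a₁ - algebraMap ℂ R a₂) * (algebraMap ℂ R a₃ - C) := by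
  simp only [acomm, Algebra.algebraMap_eq_smul_one, mul_add, add_mul, mul_sub, sub_mul,
    mul_smul_comm, smul_mul_assoc, mul_one, two_mul, neg_mul, pow_two]
  module

/-! ### The Casimirs in the centralizer and the Racah homomorphism. -/

namespace ThreeSpins

variable {V₁ V₂ V₃ : Type*}
  [AddCommGroup V₁] [Module ℂ V₁] [LieRingModule su2 V₁] [LieModule ℂ su2 V₁]
  [AddCommGroup V₂] [Module ℂ V₂] [LieRingModule su2 V₂] [LieModule ℂ su2 V₂]
  [AddCommGroup V₃] [Module ℂ V₃] [LieRingModule su2 V₃] [LieModule ℂ su2 V₃]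

variable (V₁ V₂ V₃) in
/-- The spin operators on the three factors. -/
def spins : Fin 3 → Fin 3 → Module.End ℂ (V₁ ⊗[ℂ] V₂ ⊗[ℂ] V₃) :=
  tensorOps (su2.ops V₁) (su2.ops V₂) (su2.ops V₃)

theorem K₁₂_eq : K₁₂ V₁ V₂ V₃ = normSq (spins V₁ V₂ V₃ 0 + spins V₁ V₂ V₃ 1) := rfl

theorem K₂₃_eq : K₂₃ V₁ V₂ V₃ = normSq (spins V₁ V₂ V₃ 1 + spins V₁ V₂ V₃ 2) := rfl

theorem K₁₂₃_eq : K₁₂₃ V₁ V₂ V₃ =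
    normSq (spins V₁ V₂ V₃ 0 + spins V₁ V₂ V₃ 1 + spins V₁ V₂ V₃ 2) := rfl

theorem isVectorOperator_spins (i : Fin 3) :
    IsVectorOperator (spins V₁ V₂ V₃ i) (spins V₁ V₂ V₃ i) :=
  tensorOps_isVectorOperator (su2.isVectorOperator_ops V₁) (su2.isVectorOperator_ops V₂)
    (su2.isVectorOperator_ops V₃) i

theorem spins_mul_spins {i j : Fin 3} (hij : i ≠ j) (a b : Fin 3) :
    spins V₁ V₂ V₃ i a * spins V₁ V₂ V₃ j b = spins V₁ V₂ V₃ j b * spins V₁ V₂ V₃ i a :=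
  (tensorOps_commute hij a b).eq

theorem normSq_spins {n₁ n₂ n₃ : ℕ} (h₁ : IsSpinRep n₁ V₁) (h₂ : IsSpinRep n₂ V₂)
    (h₃ : IsSpinRep n₃ V₃) (i : Fin 3) :
    normSq (spins V₁ V₂ V₃ i) = algebraMap ℂ _ (casimirValue (![n₁, n₂, n₃] i)) := by
  have e₁ := normSq_map (R := Module.End ℂ V₁) (S := Module.End ℂ (V₁ ⊗[ℂ] V₂ ⊗[ℂ] V₃))
    (onFirst V₁ V₂ V₃) (su2.ops V₁)
  have e₂ := normSq_map (R := Module.End ℂ V₂) (S := Module.End ℂ (V₁ ⊗[ℂ] V₂ ⊗[ℂ] V₃))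
    (onSecond V₁ V₂ V₃) (su2.ops V₂)
  have e₃ := normSq_map (R := Module.End ℂ V₃) (S := Module.End ℂ (V₁ ⊗[ℂ] V₂ ⊗[ℂ] V₃))
    (onThird V₁ V₂ V₃) (su2.ops V₃)
  rw [h₁.normSq_ops, AlgHom.commutes] at e₁
  rw [h₂.normSq_ops, AlgHom.commutes] at e₂
  rw [h₃.normSq_ops, AlgHom.commutes] at e₃
  fin_cases i <;> assumption

theorem isVectorOperator_total : IsVectorOperator
    (spins V₁ V₂ V₃ 0 + spins V₁ V₂ V₃ 1 + spins V₁ V₂ V₃ 2)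
    (spins V₁ V₂ V₃ 0 + spins V₁ V₂ V₃ 1 + spins V₁ V₂ V₃ 2) := by
  have h₃ : ∀ a b, spins V₁ V₂ V₃ 2 a * (spins V₁ V₂ V₃ 0 + spins V₁ V₂ V₃ 1) b =
      (spins V₁ V₂ V₃ 0 + spins V₁ V₂ V₃ 1) b * spins V₁ V₂ V₃ 2 a := fun a b => by
    simp only [Pi.add_apply, mul_add, add_mul, spins_mul_spins (show (2 : Fin 3) ≠ 0 by decide),
      spins_mul_spins (show (2 : Fin 3) ≠ 1 by decide)]
  exact ((isVectorOperator_spins 0).add (spins_mul_spins (by decide))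
    (spins_mul_spins (by decide)) (isVectorOperator_spins 1)).add h₃ (fun a b => (h₃ b a).symm)
    (isVectorOperator_spins 2)

theorem mem_centralizer {M : Module.End ℂ (V₁ ⊗[ℂ] V₂ ⊗[ℂ] V₃)} : M ∈ centralizer V₁ V₂ V₃ ↔
    ∀ a, (spins V₁ V₂ V₃ 0 + spins V₁ V₂ V₃ 1 + spins V₁ V₂ V₃ 2) a * M =
      M * (spins V₁ V₂ V₃ 0 + spins V₁ V₂ V₃ 1 + spins V₁ V₂ V₃ 2) a := by
  rw [centralizer, Subalgebra.mem_centralizer_iff, Set.forall_mem_range]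
  rfl

/-- The total spin is L plus a spin commuting with L, and L² commutes with both parts. -/
theorem normSq_commute_total {L : Fin 3 → Module.End ℂ (V₁ ⊗[ℂ] V₂ ⊗[ℂ] V₃)} {i : Fin 3}
    (hL : IsVectorOperator L L) (hi : ∀ a b, L a * spins V₁ V₂ V₃ i b = spins V₁ V₂ V₃ i b * L a)
    (hLi : L + spins V₁ V₂ V₃ i = spins V₁ V₂ V₃ 0 + spins V₁ V₂ V₃ 1 + spins V₁ V₂ V₃ 2) :
    normSq L ∈ centralizer V₁ V₂ V₃ := by
  refine mem_centralizer.mpr fun a => ?_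
  rw [← hLi, Pi.add_apply, add_mul, mul_add, hL.normSq_commute,
    normSq_commute_of fun b => (hi b a).symm]

theorem K₁₂_mem : K₁₂ V₁ V₂ V₃ ∈ centralizer V₁ V₂ V₃ := by
  rw [K₁₂_eq]
  refine normSq_commute_total (i := 2) ((isVectorOperator_spins 0).add
    (spins_mul_spins (show (1 : Fin 3) ≠ 0 by decide))
    (spins_mul_spins (show (0 : Fin 3) ≠ 1 by decide)) (isVectorOperator_spins 1))
    (fun a b => ?_) rfl
  simp only [Pi.add_apply, mul_add, add_mul, spins_mul_spins (show (2 : Fin 3) ≠ 0 by decide),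
    spins_mul_spins (show (2 : Fin 3) ≠ 1 by decide)]

theorem K₂₃_mem : K₂₃ V₁ V₂ V₃ ∈ centralizer V₁ V₂ V₃ := by
  rw [K₂₃_eq]
  refine normSq_commute_total (i := 0) ((isVectorOperator_spins 1).add
    (spins_mul_spins (show (2 : Fin 3) ≠ 1 by decide))
    (spins_mul_spins (show (1 : Fin 3) ≠ 2 by decide)) (isVectorOperator_spins 2))
    (fun a b => ?_) ?_
  · simp only [Pi.add_apply, mul_add, add_mul, spins_mul_spins (show (0 : Fin 3) ≠ 1 by decide),
      spins_mul_spins (show (0 : Fin 3) ≠ 2 by decide)]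
  · abel

theorem K₁₂₃_commute {M : Module.End ℂ (V₁ ⊗[ℂ] V₂ ⊗[ℂ] V₃)} (hM : M ∈ centralizer V₁ V₂ V₃) :
    K₁₂₃ V₁ V₂ V₃ * M = M * K₁₂₃ V₁ V₂ V₃ := by
  have h : ∀ a, M * (spins V₁ V₂ V₃ 0 + spins V₁ V₂ V₃ 1 + spins V₁ V₂ V₃ 2) a =
      (spins V₁ V₂ V₃ 0 + spins V₁ V₂ V₃ 1 + spins V₁ V₂ V₃ 2) a * M :=
    fun a => (mem_centralizer.mp hM a).symm
  rw [K₁₂₃_eq]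
  exact normSq_commute_of h

theorem K₁₂₃_mem : K₁₂₃ V₁ V₂ V₃ ∈ centralizer V₁ V₂ V₃ :=
  mem_centralizer.mpr fun a => (isVectorOperator_total.normSq_commute a).symm

/-- The intermediate Casimir operators generate the centralizer. -/
theorem adjoin_eq_centralizer {n₁ n₂ n₃ : ℕ} (h₁ : IsSpinRep n₁ V₁) (h₂ : IsSpinRep n₂ V₂)
    (h₃ : IsSpinRep n₃ V₃) :
    Algebra.adjoin ℂ {K₁₂ V₁ V₂ V₃, K₂₃ V₁ V₂ V₃, K₁₂₃ V₁ V₂ V₃} = centralizer V₁ V₂ V₃ := by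
  refine le_antisymm (Algebra.adjoin_le ?_) fun M hM => ?_
  · rintro _ (rfl | rfl | rfl)
    exacts [K₁₂_mem, K₂₃_mem, K₁₂₃_mem]
  have := h₁.finiteDimensional
  have := h₂.finiteDimensional
  have := h₃.finiteDimensional
  obtain ⟨Ω₁, o₁, li₁, r₁, w₁⟩ := h₁.exists_isSpinVector
  obtain ⟨Ω₂, o₂, li₂, r₂, w₂⟩ := h₂.exists_isSpinVector
  obtain ⟨Ω₃, o₃, li₃, r₃, w₃⟩ := h₃.exists_isSpinVector
  obtain ⟨b₁, N₁, hN₁, e₁, s₁⟩ := o₁.exists_weightedCore r₁ w₁ li₁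
  obtain ⟨b₂, N₂, hN₂, e₂, s₂⟩ := o₂.exists_weightedCore r₂ w₂ li₂
  obtain ⟨b₃, N₃, hN₃, e₃, s₃⟩ := o₃.exists_weightedCore r₃ w₃ li₃
  obtain ⟨c, hc⟩ := tensorOps_symm b₁ b₂ b₃ hN₁ hN₂ hN₃ s₁ s₂ s₃
  refine mem_adjoin_normSq c isVectorOperator_spins hc (fun hij => tensorOps_commute hij)
    (tensorOps_Ω o₁ o₂ o₃) ?_ (mem_centralizer.mp hM)
  -- The vectors of the tensor product basis are themselves monomials in the lowering operators
  -- applied to Ω₁ ⊗ Ω₂ ⊗ Ω₃.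
  rw [eq_top_iff, ← ((b₁.tensorProduct b₂).tensorProduct b₃).span_eq]
  refine Submodule.span_mono ?_
  rintro _ ⟨⟨⟨i, j⟩, k⟩, rfl⟩
  refine ⟨i, j, k, ?_⟩
  rw [Module.Basis.tensorProduct_apply, Module.Basis.tensorProduct_apply, e₁, e₂, e₃]
  exact (tensorOps_mono Ω₁ Ω₂ Ω₃ i j k).symm

variable (V₁ V₂ V₃) in
/-- The images of the generators of the Racah algebra. -/
def genImage (n : Fin 3 → ℕ) : Gen → centralizer V₁ V₂ V₃
  | .A => ⟨K₁₂ V₁ V₂ V₃, K₁₂_mem⟩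
  | .B => ⟨K₂₃ V₁ V₂ V₃, K₂₃_mem⟩
  | .C => ⟨K₁₂₃ V₁ V₂ V₃, K₁₂₃_mem⟩
  | .α i => algebraMap ℂ _ (casimirValue (n i))

theorem comm_K₂₃ {n₁ n₂ n₃ : ℕ} (h₁ : IsSpinRep n₁ V₁) (h₂ : IsSpinRep n₂ V₂)
    (h₃ : IsSpinRep n₃ V₃) :
    Racah.comm (K₂₃ V₁ V₂ V₃) (Racah.comm (K₁₂ V₁ V₂ V₃) (K₂₃ V₁ V₂ V₃)) =
      -2 * K₂₃ V₁ V₂ V₃ ^ 2 - 2 * acomm (K₁₂ V₁ V₂ V₃) (K₂₃ V₁ V₂ V₃) +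
        2 * (K₁₂₃ V₁ V₂ V₃ + algebraMap ℂ _ (casimirValue n₁) + algebraMap ℂ _ (casimirValue n₂) +
          algebraMap ℂ _ (casimirValue n₃)) * K₂₃ V₁ V₂ V₃ +
        2 * (algebraMap ℂ _ (casimirValue n₁) - K₁₂₃ V₁ V₂ V₃) *
          (algebraMap ℂ _ (casimirValue n₃) - algebraMap ℂ _ (casimirValue n₂)) := by
  have hs := normSq_spins h₁ h₂ h₃
  have key := comm_comm_casimir (isVectorOperator_spins (V₁ := V₁) (V₂ := V₂) (V₃ := V₃) 1)
    (isVectorOperator_spins 2)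
    (spins_mul_spins (show (0 : Fin 3) ≠ 1 by decide))
    (spins_mul_spins (show (0 : Fin 3) ≠ 2 by decide))
    (spins_mul_spins (show (1 : Fin 3) ≠ 2 by decide)) (hs 0) (hs 1) (hs 2)
  rw [← K₁₂_eq, ← K₂₃_eq, ← K₁₂₃_eq] at key
  exact key

/-- Exchanging spins 1 and 3 swaps K₁₂ with K₂₃ and fixes K₁₂₃, so this is the same identity applied
to the spins in reverse order. -/
theorem comm_K₁₂ {n₁ n₂ n₃ : ℕ} (h₁ : IsSpinRep n₁ V₁) (h₂ : IsSpinRep n₂ V₂)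
    (h₃ : IsSpinRep n₃ V₃) :
    Racah.comm (K₁₂ V₁ V₂ V₃) (Racah.comm (K₂₃ V₁ V₂ V₃) (K₁₂ V₁ V₂ V₃)) =
      -2 * K₁₂ V₁ V₂ V₃ ^ 2 - 2 * acomm (K₁₂ V₁ V₂ V₃) (K₂₃ V₁ V₂ V₃) +
        2 * (K₁₂₃ V₁ V₂ V₃ + algebraMap ℂ _ (casimirValue n₁) + algebraMap ℂ _ (casimirValue n₂) +
          algebraMap ℂ _ (casimirValue n₃)) * K₁₂ V₁ V₂ V₃ +
        2 * (algebraMap ℂ _ (casimirValue n₁) - algebraMap ℂ _ (casimirValue n₂)) *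
          (algebraMap ℂ _ (casimirValue n₃) - K₁₂₃ V₁ V₂ V₃) := by
  have hs := normSq_spins h₁ h₂ h₃
  have key := comm_comm_casimir (isVectorOperator_spins (V₁ := V₁) (V₂ := V₂) (V₃ := V₃) 1)
    (isVectorOperator_spins 0)
    (spins_mul_spins (show (2 : Fin 3) ≠ 1 by decide))
    (spins_mul_spins (show (2 : Fin 3) ≠ 0 by decide))
    (spins_mul_spins (show (1 : Fin 3) ≠ 0 by decide)) (hs 2) (hs 1) (hs 0)
  rw [show spins V₁ V₂ V₃ 2 + spins V₁ V₂ V₃ 1 + spins V₁ V₂ V₃ 0 =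
    spins V₁ V₂ V₃ 0 + spins V₁ V₂ V₃ 1 + spins V₁ V₂ V₃ 2 by abel,
    add_comm (spins V₁ V₂ V₃ 1) (spins V₁ V₂ V₃ 0),
    add_comm (spins V₁ V₂ V₃ 2) (spins V₁ V₂ V₃ 1), ← K₁₂_eq, ← K₂₃_eq, ← K₁₂₃_eq] at key
  exact key.trans (racah_rhs_swap _ _ _ _ _ _)

/-- The inclusion of the centralizer is injective, so the relations may be checked among
endomorphisms. Centrality of C holds because K₁₂₃ is built from the total spin, with which the
centralizer commutes. -/
theorem lift_genImage_rel {n₁ n₂ n₃ : ℕ} (h₁ : IsSpinRep n₁ V₁) (h₂ : IsSpinRep n₂ V₂)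
    (h₃ : IsSpinRep n₃ V₃) ⦃x y : FreeAlgebra ℂ Gen⦄ (hxy : Rel x y) :
    FreeAlgebra.lift ℂ (genImage V₁ V₂ V₃ ![n₁, n₂, n₃]) x =
      FreeAlgebra.lift ℂ (genImage V₁ V₂ V₃ ![n₁, n₂, n₃]) y := by
  have hF : ∀ g, (centralizer V₁ V₂ V₃).val.comp
      (FreeAlgebra.lift ℂ (genImage V₁ V₂ V₃ ![n₁, n₂, n₃])) (gen g) =
        genImage V₁ V₂ V₃ ![n₁, n₂, n₃] g := fun g =>
    congrArg Subtype.val (FreeAlgebra.lift_ι_apply _ _)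
  suffices h : (centralizer V₁ V₂ V₃).val.comp
      (FreeAlgebra.lift ℂ (genImage V₁ V₂ V₃ ![n₁, n₂, n₃])) x =
        (centralizer V₁ V₂ V₃).val.comp
          (FreeAlgebra.lift ℂ (genImage V₁ V₂ V₃ ![n₁, n₂, n₃])) y from
    Subtype.ext h
  have hA := (hF .A).trans (show _ = K₁₂ V₁ V₂ V₃ from rfl)
  have hB := (hF .B).trans (show _ = K₂₃ V₁ V₂ V₃ from rfl)
  have hC := (hF .C).trans (show _ = K₁₂₃ V₁ V₂ V₃ from rfl)
  have h₁' := (hF (.α 0)).trans (show _ = algebraMap ℂ _ (casimirValue n₁) from rfl)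
  have h₂' := (hF (.α 1)).trans (show _ = algebraMap ℂ _ (casimirValue n₂) from rfl)
  have h₃' := (hF (.α 2)).trans (show _ = algebraMap ℂ _ (casimirValue n₃) from rfl)
  refine algHom_eq_of_rel (S := Module.End ℂ (V₁ ⊗[ℂ] V₂ ⊗[ℂ] V₃)) ((centralizer V₁ V₂ V₃).val.comp
    (FreeAlgebra.lift ℂ (genImage V₁ V₂ V₃ ![n₁, n₂, n₃]))) (fun i g => ?_) (fun g => ?_) ?_ ?_ hxy
  · rw [hF, hF]
    exact congrArg Subtype.val (Algebra.commutes (casimirValue (![n₁, n₂, n₃] i))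
      (genImage V₁ V₂ V₃ ![n₁, n₂, n₃] g))
  · rw [hF, hF]
    exact K₁₂₃_commute (genImage V₁ V₂ V₃ ![n₁, n₂, n₃] g).2
  · rw [hA, hB, hC, h₁', h₂', h₃']
    exact comm_K₂₃ h₁ h₂ h₃
  · rw [hA, hB, hC, h₁', h₂', h₃']
    exact comm_K₁₂ h₁ h₂ h₃

end ThreeSpins

theorem mainTheorem1 (n₁ n₂ n₃ : ℕ) (V₁ V₂ V₃ : Type*)
    [AddCommGroup V₁] [Module ℂ V₁] [LieRingModule su2 V₁] [LieModule ℂ su2 V₁]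
    [AddCommGroup V₂] [Module ℂ V₂] [LieRingModule su2 V₂] [LieModule ℂ su2 V₂]
    [AddCommGroup V₃] [Module ℂ V₃] [LieRingModule su2 V₃] [LieModule ℂ su2 V₃]
    (h₁ : IsSpinRep n₁ V₁) (h₂ : IsSpinRep n₂ V₂) (h₃ : IsSpinRep n₃ V₃) :
    (∃! φ : RacahAlgebra →ₐ[ℂ] ThreeSpins.centralizer V₁ V₂ V₃,
        ThreeSpins.IsRacahMap V₁ V₂ V₃ n₁ n₂ n₃ φ) ∧
      (∀ φ : RacahAlgebra →ₐ[ℂ] ThreeSpins.centralizer V₁ V₂ V₃,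
        ThreeSpins.IsRacahMap V₁ V₂ V₃ n₁ n₂ n₃ φ → Function.Surjective φ) ∧
      Algebra.adjoin ℂ {ThreeSpins.K₁₂ V₁ V₂ V₃, ThreeSpins.K₂₃ V₁ V₂ V₃,
          ThreeSpins.K₁₂₃ V₁ V₂ V₃} = ThreeSpins.centralizer V₁ V₂ V₃ := by
  have hadj := ThreeSpins.adjoin_eq_centralizer h₁ h₂ h₃
  refine ⟨?_, ?_, hadj⟩
  · let φ : RacahAlgebra →ₐ[ℂ] ThreeSpins.centralizer V₁ V₂ V₃ := RingQuot.liftAlgHom ℂ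
      ⟨FreeAlgebra.lift ℂ (ThreeSpins.genImage V₁ V₂ V₃ ![n₁, n₂, n₃]),
        ThreeSpins.lift_genImage_rel h₁ h₂ h₃⟩
    have hφ : ∀ g, φ (RacahAlgebra.of g) = ThreeSpins.genImage V₁ V₂ V₃ ![n₁, n₂, n₃] g :=
      fun g => (RingQuot.liftAlgHom_mkAlgHom_apply _ _ _ _).trans (FreeAlgebra.lift_ι_apply _ _)
    refine ⟨φ, ⟨congrArg Subtype.val (hφ .A), congrArg Subtype.val (hφ .B),
      congrArg Subtype.val (hφ .C), hφ (.α 0), hφ (.α 1), hφ (.α 2)⟩, fun ψ hψ => ?_⟩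
    refine RingQuot.ringQuot_ext' ℂ ψ φ (FreeAlgebra.hom_ext (funext fun g => ?_))
    change ψ (RacahAlgebra.of g) = φ (RacahAlgebra.of g)
    rw [hφ]
    cases g with
    | A => exact Subtype.ext hψ.map_A
    | B => exact Subtype.ext hψ.map_B
    | C => exact Subtype.ext hψ.map_C
    | α i =>
      fin_cases i
      exacts [hψ.map_α₁, hψ.map_α₂, hψ.map_α₃]
  · intro φ hφ y
    -- The image of φ, viewed among all endomorphisms, is a subalgebra containing the three
    -- Casimirs, hence the whole centralizer.
    have hle : Algebra.adjoin ℂ {ThreeSpins.K₁₂ V₁ V₂ V₃, ThreeSpins.K₂₃ V₁ V₂ V₃,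
        ThreeSpins.K₁₂₃ V₁ V₂ V₃} ≤ ((ThreeSpins.centralizer V₁ V₂ V₃).val.comp φ).range := by
      refine Algebra.adjoin_le ?_
      rintro _ (rfl | rfl | rfl)
      exacts [⟨_, hφ.map_A⟩, ⟨_, hφ.map_B⟩, ⟨_, hφ.map_C⟩]
    have hy : (y : Module.End ℂ (V₁ ⊗[ℂ] V₂ ⊗[ℂ] V₃)) ∈ Algebra.adjoin ℂ
        {ThreeSpins.K₁₂ V₁ V₂ V₃, ThreeSpins.K₂₃ V₁ V₂ V₃, ThreeSpins.K₁₂₃ V₁ V₂ V₃} := by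
      rw [hadj]
      exact y.2
    obtain ⟨x, hx⟩ := hle hy
    exact ⟨x, Subtype.ext hx⟩
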